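/- \textbf{Setting.} A Feynman diagram $G$ of a scalar theory with nonderivative vertices consists of a finite nonempty set of vertices $\nu$ with real couplings $\lambda_\nu$, finitely many internal legs $\ell_i$, each oriented from a vertex to a vertex and with a real mass $m_i$, and finitely many external legs attached to vertices, with external momenta $p_1,\dots,p_n$. Parallel legs, legs that begin and end at the same vertex (\emph{tadpole legs}) and disconnected diagrams are allowed. Momenta are pairs $(k^0,\mathbf k)$, with $k^0\in\mathbb R$ and $\mathbf k$ in a real inner product space $E$ ($E=\mathbb R^{D-1}$ in $D$ dimensions). Each leg has its own arbitrary width $\epsilon_i>0$. With $\omega=\sqrt{\mathbf k^2+m^2-i\epsilon}$ (principal branch), put $$\sigma^{\pm}=\pm\frac1{2\omega}\,\frac1{k^0\mp\omega},\qquad \tau^\pm=-(\sigma^{\mp})^*,\qquad z=\sigma^++\sigma^-,\quad w=\tau^++\tau^-,\quad u=\sigma^++\tau^-,\quad v=\sigma^-+\tau^+ .$$ For a set $M$ of marked vertices, $G_M$ has as integrand the product of $-i\lambda_\nu$ for each unmarked vertex, $+i\lambda_\nu$ for each marked vertex, and $i$ times a propagator for each internal leg: $z$ (both ends unmarked), $w$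 (both ends marked), $u$ (oriented from an unmarked to a marked vertex), $v$ (oriented from a marked to an unmarked vertex). The leg momenta are a fixed distribution of the external momenta that conserves momentum at every vertex, plus $\sum_{j=1}^L c_{ij}k_j$, where the columns of $(c_{ij})$ form a basis of the space of flows conserved at every vertex and $k_1,\dots,k_L$ are the loop momenta. Write $G$, $\bar G$ for the diagrams with no vertex, respectively every vertex, marked. A marking is \emph{proper} if it has a marked and an unmarked vertex. The cutting equation is $$G+\bar G=-\sum_{\text{proper markings }M}G_M. \qquad(*)$$ A polar monomial is a product of one of $\sigma_i^\pm,\tau_i^\pm$ for each internal leg. A minimal loop (a cycle without repeated vertices or legs) is polarized if adjacent legs in it have equal polarities exactly when their orientations along the loop are coherent; a monomial is polarized if some such loop is polarized. \textbf{Theorem.} (1) Let $G$ have no tadpole legs. (a) If an energy $e$ circulates in a polarized loop of a polarized monomial, the monomial is absolutely integrable over $e\in\mathbb R$, and its integral is $0$, for all fixed values of the other momentum variables. (b) For every marking $M$ and all fixed space components of the loop momenta, the integral of $G_M$ over the loop energies, with measure $\prod_j dk^0_j/(2\pi)$, converges absolutely; the resulting functions of the space components satisfy $(*)$ pointwise;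 hence $(*)$ also holds when these functions are integrated over the space components by any prescription $R$ that is a linear map, with values in a complex vector space, on some linear space of functions containing them. (c) In $D=d+1$ dimensions let $G_M$ be the integral with measure $\prod_j d^Dk_j/(2\pi)^D$, the space components of the loop momenta ranging over a measurable set $\Lambda$. If these integrals converge absolutely for all $M$, then $(*)$ holds. If $\Lambda$ is bounded, they do converge absolutely. (2) Let $G$ be arbitrary, and let $\hat G$ be $G$ with the tadpole legs suppressed. Suppose the loop integral of each tadpole leg $i$ is given a value $t_i$ when its vertex is unmarked and $\bar t_i$ when it is marked, such that the \emph{tadpole assumption} holds: for every vertex $\nu$ with tadpole legs, $-i\lambda_\nu\prod_{i\text{ at }\nu}t_i=-\big(i\lambda_\nu\prod_{i\text{ at }\nu}\bar t_i\big)$. Then $(*)$ holds for $G_M:=\big(\prod_{i}t_i\text{ or }\bar t_i\big)\,R[\hat G_M]$, where $\hat G_M$ is integrated over its loop energies and then over its space components by any linear prescription $R$ as in (1b). (3) Let the tadpole legs have positive masses. For fixed space components, the integrals of the $G_M$ over all loop energies, those of the tadpoles included, converge absolutely. When the widths of the tadpole legs tend to $0^+$ independently, the other widths being kept fixed, these integrals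 have limits, and the limits satisfy $(*)$, pointwise and after any linear prescription $R$ for the space components. (4) Define the dimensionally regularized integral $\int d^{D-1}k/(2\pi)^{D-1}\,F(|\mathbf k|)$ as the meromorphic continuation in $D\in\mathbb C$ of $$\frac{2\pi^{(D-1)/2}}{\Gamma((D-1)/2)(2\pi)^{D-1}}\int_0^\infty r^{D-2}F(r)\,dr$$ from a strip of absolute convergence. For $m,\epsilon>0$ and $F=\int\frac{dk^0}{2\pi}\,iz$ (unmarked vertex) or $F=\int\frac{dk^0}{2\pi}\,iw$ (marked vertex), this continuation exists and equals $$\frac{\Gamma(1-\frac D2)}{(4\pi)^{D/2}}(m^2\mp i\epsilon)^{(D-2)/2},$$ with the upper sign for the unmarked and the lower sign for the marked vertex. (5) Let the tadpole legs have positive masses and let $D\in\mathbb C\setminus\{2,4,6,\dots\}$. When $\epsilon\to0^+$ in the tadpoles, their dimensionally regularized values tend to $t_i=\bar t_i=\Gamma(1-\frac D2)\,(4\pi)^{-D/2}\,m_i^{D-2}$. These satisfy the tadpole assumption, and therefore $(*)$ holds for $G$ as in (2) with these values, with arbitrary positive widths in all the other legs. -/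

import Mathlib

open Filter Topology MeasureTheory Set
open scoped BigOperators ComplexConjugate

noncomputable section

/-- The complex frequency `ω = √(r² + m² - iε)` (principal branch) of a leg of mass `m` and width `ε`
whose space momentum has length `r`. -/
def frequency (ε m r : ℝ) : ℂ :=
  ((r : ℂ) ^ 2 + (m : ℂ) ^ 2 - Complex.I * (ε : ℂ)) ^ (1 / 2 : ℂ)

/-- The polar number `σ^s = s / (2ω) * 1 / (k⁰ - s ω)` of polarity `s = ±1`. -/
def polarSigma (ω : ℂ) (s : ℤˣ) (k0 : ℝ) : ℂ :=
  ((s : ℤ) : ℂ) * (1 / (2 * ω)) * (1 / ((k0 : ℂ) - ((s : ℤ) : ℂ) * ω))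

/-- The polar number `τ^s = - (σ^{-s})^*` of polarity `s = ±1`. -/
def polarTau (ω : ℂ) (s : ℤˣ) (k0 : ℝ) : ℂ :=
  -conj (polarSigma ω (-s) k0)

/-- `τ^s` if `isTau` is true and `σ^s` otherwise. -/
def polarNumber (ω : ℂ) (isTau : Bool) (s : ℤˣ) (k0 : ℝ) : ℂ :=
  if isTau then polarTau ω s k0 else polarSigma ω s k0

/-- The propagators `z`, `w`, `u`, `v` of an oriented leg. The Booleans tell whether the vertex from
which the leg points away, and the vertex to which it points, are marked. -/
def propagator (ω : ℂ) : (srcMarked tgtMarked : Bool) → (k0 : ℝ) → ℂ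
  | false, false => fun k0 => polarSigma ω 1 k0 + polarSigma ω (-1) k0
  | true, true => fun k0 => polarTau ω 1 k0 + polarTau ω (-1) k0
  | false, true => fun k0 => polarSigma ω 1 k0 + polarTau ω (-1) k0
  | true, false => fun k0 => polarSigma ω (-1) k0 + polarTau ω 1 k0

/-- The cutting equation for a quantity that depends on the set `M` of marked vertices:
`F(nothing marked) + F(everything marked) = - ∑ F(M)`, the sum being over the proper markings. -/
def CuttingEquation {V A : Type*} [Fintype V] [DecidableEq V] [AddCommGroup A]
    (F : Finset V → A) : Prop :=
  F ∅ + F Finset.univ = -∑ M : Finset V with (M.Nonempty ∧ M ≠ Finset.univ), F M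

/-- A Feynman diagram of a scalar theory with nonderivative vertices: `V` is the type of the (internal)
vertices, `Leg` that of the internal legs, `X` that of the external legs. Parallel legs, legs that begin
and end at the same vertex, and disconnected diagrams are allowed. Each internal leg is oriented from
`src` to `tgt` and has a mass; each vertex has a real coupling. -/
structure FeynmanDiagram (V Leg X : Type*) where
  src : Leg → V
  tgt : Leg → V
  ext : X → V
  coupling : V → ℝ
  mass : Leg → ℝ

namespace FeynmanDiagram

/-- A leg that begins and ends at the same vertex. -/
def IsTadpole {V Leg X : Type*} (G : FeynmanDiagram V Leg X) (i : Leg) : Prop :=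
  G.src i = G.tgt i

instance {V Leg X : Type*} [DecidableEq V] (G : FeynmanDiagram V Leg X) :
    DecidablePred G.IsTadpole :=
  fun i => inferInstanceAs (Decidable (G.src i = G.tgt i))

def TadpoleFree {V Leg X : Type*} (G : FeynmanDiagram V Leg X) : Prop :=
  ∀ i, ¬ G.IsTadpole i

/-- The diagram obtained by suppressing the legs that begin and end at the same vertex. -/
def dropTadpoles {V Leg X : Type*} (G : FeynmanDiagram V Leg X) :
    FeynmanDiagram V {i : Leg // ¬ G.IsTadpole i} X where
  src i := G.src i
  tgt i := G.tgt i
  ext := G.ext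
  coupling := G.coupling
  mass i := G.mass i

/-- A minimal loop, together with a sense in which it is run through: the vertices
`vert 0, vert 1, …, vert len, vert 0` are joined by the legs `leg 0, …, leg len`, no vertex and no leg
being repeated (indices are cyclic). `dir t` is `1` if `leg t` is run through along its orientation and
`-1` if it is run through against it. -/
structure Loop {V Leg X : Type*} (G : FeynmanDiagram V Leg X) where
  len : ℕ
  vert : Fin (len + 1) → V
  leg : Fin (len + 1) → Leg
  dir : Fin (len + 1) → ℤˣ
  vert_injective : Function.Injective vert
  leg_injective : Function.Injective leg
  forward : ∀ t, dir t = 1 → G.src (leg t) = vert t ∧ G.tgt (leg t) = vert (t + 1)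
  backward : ∀ t, dir t = -1 → G.src (leg t) = vert (t + 1) ∧ G.tgt (leg t) = vert t

/-- With `s i` the polarity of the polar number carried by the leg `i`, the loop is polarized: adjacent
legs carry the same polarity if and only if their orientations are coherent. -/
def Loop.Polarized {V Leg X : Type*} {G : FeynmanDiagram V Leg X} (γ : G.Loop) (s : Leg → ℤˣ) : Prop :=
  ∀ t, s (γ.leg t) = s (γ.leg (t + 1)) ↔ γ.dir t = γ.dir (t + 1)

/-- The energy, oriented along the leg `i`, that a unit energy circulating in the loop adds to `i`. -/
def Loop.flow {V Leg X : Type*} [DecidableEq Leg] {G : FeynmanDiagram V Leg X} (γ : G.Loop)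
    (i : Leg) : ℝ :=
  ∑ t, if γ.leg t = i then ((γ.dir t : ℤ) : ℝ) else 0

/-- The flows through the internal legs that are conserved at each vertex. -/
def closedFlows {V Leg X : Type*} [DecidableEq V] [Fintype Leg] (G : FeynmanDiagram V Leg X) :
    Submodule ℝ (Leg → ℝ) where
  carrier := {f | ∀ v, ∑ i with G.tgt i = v, f i = ∑ i with G.src i = v, f i}
  add_mem' := by
    intro f g hf hg v
    simp only [Pi.add_apply, Finset.sum_add_distrib]
    rw [hf v, hg v]
  zero_mem' := by
    intro v
    simp
  smul_mem' := by
    intro c f hf v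
    simp only [Pi.smul_apply, smul_eq_mul, ← Finset.mul_sum]
    rw [hf v]

/-- A parametrization of the momenta of the internal legs by `L` loop momenta, given the external momenta
`p` (energy and space momentum, flowing into the diagram): a basis of the space of closed flows tells how
each loop momentum flows, and `offset` is a distribution of the external momenta over the internal legs
that conserves momentum at each vertex. -/
structure Routing {V Leg X E : Type*} [DecidableEq V] [Fintype Leg] [Fintype X]
    [NormedAddCommGroup E] [InnerProductSpace ℝ E]
    (G : FeynmanDiagram V Leg X) (L : ℕ) (p : X → ℝ × E) where
  loops : Module.Basis (Fin L) ℝ G.closedFlows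
  offset : Leg → ℝ × E
  conserved : ∀ v, ∑ i with G.tgt i = v, offset i + ∑ x with G.ext x = v, p x
    = ∑ i with G.src i = v, offset i

/-- The momentum of the leg `i` when the loop momenta have energies `e` and space momenta `k`. -/
def Routing.momentum {V Leg X E : Type*} [DecidableEq V] [Fintype Leg] [Fintype X]
    [NormedAddCommGroup E] [InnerProductSpace ℝ E]
    {G : FeynmanDiagram V Leg X} {L : ℕ} {p : X → ℝ × E} (ρ : G.Routing L p)
    (e : Fin L → ℝ) (k : Fin L → E) (i : Leg) : ℝ × E :=
  ρ.offset i + ∑ j, (ρ.loops j : Leg → ℝ) i • (e j, k j)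

/-- The integrand of the diagram whose marked vertices are those of `M`. An unmarked vertex contributes
`-iλ`, a marked one `iλ`, and a leg contributes `i` times its propagator, with width `ε i`. -/
def integrand {V Leg X E : Type*} [Fintype V] [DecidableEq V] [Fintype Leg] [Fintype X]
    [NormedAddCommGroup E] [InnerProductSpace ℝ E]
    (G : FeynmanDiagram V Leg X) (ε : Leg → ℝ) {L : ℕ} {p : X → ℝ × E} (ρ : G.Routing L p)
    (M : Finset V) (e : Fin L → ℝ) (k : Fin L → E) : ℂ :=
  (∏ v, if v ∈ M then Complex.I * (G.coupling v : ℂ) else -(Complex.I * (G.coupling v : ℂ))) *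
    ∏ i, Complex.I * propagator (frequency (ε i) (G.mass i) ‖(ρ.momentum e k i).2‖)
      (decide (G.src i ∈ M)) (decide (G.tgt i ∈ M)) (ρ.momentum e k i).1

/-- The marked diagram integrated over the loop energies, as a function of the space components of the
loop momenta. -/
def energyValue {V Leg X E : Type*} [Fintype V] [DecidableEq V] [Fintype Leg] [Fintype X]
    [NormedAddCommGroup E] [InnerProductSpace ℝ E]
    (G : FeynmanDiagram V Leg X) (ε : Leg → ℝ) {L : ℕ} {p : X → ℝ × E} (ρ : G.Routing L p)
    (M : Finset V) (k : Fin L → E) : ℂ :=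
  ((2 * Real.pi : ℂ)⁻¹) ^ L * ∫ e : Fin L → ℝ, G.integrand ε ρ M e k

/-- The marked diagram in `D = d + 1` dimensions, integrated over the loop momenta with the measure
`∏ d^D k / (2π)^D`, where the space components of the loop momenta range over the region `Λ`. -/
def loopValue {V Leg X : Type*} [Fintype V] [DecidableEq V] [Fintype Leg] [Fintype X] {d : ℕ}
    (G : FeynmanDiagram V Leg X) (ε : Leg → ℝ) {L : ℕ} {p : X → ℝ × EuclideanSpace ℝ (Fin d)}
    (ρ : G.Routing L p) (Λ : Set (Fin L → EuclideanSpace ℝ (Fin d))) (M : Finset V) : ℂ :=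
  (((2 * Real.pi : ℂ) ^ (d + 1))⁻¹) ^ L *
    ∫ x : (Fin L → ℝ) × (Fin L → EuclideanSpace ℝ (Fin d)) in univ ×ˢ Λ, G.integrand ε ρ M x.1 x.2

/-- The widths `η` in the tadpoles and `ε` everywhere else. -/
def withTadpoleWidths {V Leg X : Type*} [DecidableEq V] (G : FeynmanDiagram V Leg X)
    (ε η : Leg → ℝ) (i : Leg) : ℝ :=
  if G.IsTadpole i then η i else ε i

/-- The tadpole assumption, `t i b` being the value of the loop integral of the tadpole leg `i` when the
vertex it is attached to is unmarked (`b = false`) or marked (`b = true`): at each vertex, the value of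
the tadpole formed by the vertex and the tadpole legs attached to it is opposite to the value of its
marked version. -/
def TadpoleAssumption {V Leg X : Type*} [DecidableEq V] [Fintype Leg]
    (G : FeynmanDiagram V Leg X) (t : Leg → Bool → ℂ) : Prop :=
  ∀ v, (∃ i, G.IsTadpole i ∧ G.src i = v) →
    -(Complex.I * (G.coupling v : ℂ)) * ∏ i with (G.IsTadpole i ∧ G.src i = v), t i false
    = -((Complex.I * (G.coupling v : ℂ)) * ∏ i with (G.IsTadpole i ∧ G.src i = v), t i true)

/-- The product of the loop integrals `t` of the tadpole legs of the marked diagram. -/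
def tadpoleFactor {V Leg X : Type*} [DecidableEq V] [Fintype Leg]
    (G : FeynmanDiagram V Leg X) (t : Leg → Bool → ℂ) (M : Finset V) : ℂ :=
  ∏ i with G.IsTadpole i, t i (decide (G.src i ∈ M))

end FeynmanDiagram

/-- The loop integral `∫ dk⁰/(2π) i z` (unmarked vertex) or `∫ dk⁰/(2π) i w` (marked vertex) over the
energy of a tadpole leg of mass `m` and width `ε`, as a function of the length `r` of its space momentum. -/
def tadpoleEnergyValue (m ε : ℝ) (marked : Bool) (r : ℝ) : ℂ :=
  (2 * Real.pi : ℂ)⁻¹ * ∫ k0 : ℝ, Complex.I * propagator (frequency ε m r) marked marked k0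

/-- `f` is the dimensionally regularized integral `∫ d^{D-1}k/(2π)^{D-1} F(|k|)` of a rotationally
invariant function: it is meromorphic in the complex dimension `D` and equal, in some strip, to the
convergent radial integral, `2π^{d/2}/Γ(d/2)` being the area of the unit sphere in `d = D - 1`
dimensions. (Normal form fixes the values at removable singularities and is `0` at the poles.) -/
def IsDimReg (F : ℝ → ℂ) (f : ℂ → ℂ) : Prop :=
  MeromorphicNFOn f univ ∧ ∃ a b : ℝ, a < b ∧ ∀ D : ℂ, a < D.re → D.re < b →
    IntegrableOn (fun r : ℝ => (r : ℂ) ^ (D - 2) * F r) (Ioi 0) ∧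
    f D = 2 * (Real.pi : ℂ) ^ ((D - 1) / 2) * (Complex.Gamma ((D - 1) / 2))⁻¹
      * ((2 * Real.pi : ℂ) ^ (D - 1))⁻¹ * ∫ r : ℝ in Ioi 0, (r : ℂ) ^ (D - 2) * F r

open Classical in
/-- The dimensionally regularized integral of `F`, as a function of the dimension. -/
def dimReg (F : ℝ → ℂ) : ℂ → ℂ :=
  if h : ∃ f, IsDimReg F f then h.choose else 0

end

/-! Each propagator is a sum of two polar numbers, and the summand of polarity +1 depends only on
whether the source of the leg is marked, that of polarity -1 only on whether the target is
(`propagator_eq`). Multiplied out, a marked diagram is a sum over polarity choices `s` of monomials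
in which every leg sees the marking through one vertex only, its `baseVertex`. The cutting equation
says that the sum over all markings vanishes (`cuttingEquation_iff`), so the two sums can be
exchanged and `s` kept fixed.

If some vertex is the base of no leg, toggling its mark leaves the monomial unchanged and reverses
the sign of the vertex factor, and the markings cancel in pairs. Otherwise, going from each vertex
along a leg based there to its other end defines a self-map of a finite set. A periodic orbit of it
is a polarized loop (`exists_polarized_loop`), whatever the marking. The half plane of a pole is
determined by the polarity, equally for σ and τ (`polarPole_im`), so all poles in the energy of that
loop lie on the same side of the real line. Without tadpoles there are at least two of them, and
closing the contour on the other side gives zero (`integral_polarized_loop`).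

To apply this inside the integral over all loop energies, absolute convergence is needed. A nonzero
closed flow is never supported on a single leg that is not a tadpole. Hence the leg energies still
determine the loop energies after one leg is left out, and this surplus of one factor makes the
product of 1/|k⁰| decays integrable (`integrable_prod_inv_one_add_abs`).

Tadpole energies decouple from the rest: the integral factorizes, each tadpole giving π/ω or its
conjugate. For positive mass these have the same limit as the width vanishes, so the tadpoles become
a common factor of all markings. In dimensional regularization, a Gamma-function integral for the
inverse square root and Fubini evaluate the radial integral for 1 < Re D < 2, and the identity
theorem gives the continuation. -/

/-! ### Contour integration -/

/-- Along the real line, a function that is holomorphic in the closed upper half plane and of order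
`|z|⁻²` there integrates to zero. -/
theorem integral_eq_zero_of_differentiableAt_upper (f : ℂ → ℂ) (C : ℝ)
    (hd : ∀ z : ℂ, 0 ≤ z.im → DifferentiableAt ℂ f z)
    (hC : ∀ z : ℂ, 0 ≤ z.im → ‖f z‖ ≤ C / (1 + ‖z‖) ^ 2) :
    Integrable (fun x : ℝ => f x) ∧ ∫ x : ℝ, f x = 0 := by
  have hC0 : 0 ≤ C := by
    have := (norm_nonneg _).trans (hC 0 le_rfl)
    simpa using this
  have hcont : Continuous (fun x : ℝ => f x) := by
    rw [continuous_iff_continuousAt]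
    intro x
    exact ContinuousAt.comp (hd x (by simp)).continuousAt Complex.continuous_ofReal.continuousAt
  have hint : Integrable (fun x : ℝ => f x) := by
    have h1 : Integrable (fun x : ℝ => C * (1 + ‖x‖) ^ (-(2 : ℝ))) :=
      (integrable_one_add_norm (by simp)).const_mul C
    refine h1.mono' hcont.aestronglyMeasurable (ae_of_all _ fun x => ?_)
    have h2 := hC x (by simp)
    rw [Real.rpow_neg (by positivity), Real.rpow_two, ← div_eq_mul_inv]
    simpa using h2
  refine ⟨hint, ?_⟩
  have hlim := intervalIntegral_tendsto_integral hint tendsto_neg_atTop_atBot tendsto_id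
  refine tendsto_nhds_unique hlim ?_
  -- Cauchy on the rectangle with base [-R, R] and height R: the other three sides have total length
  -- 4R and stay at distance at least R from the origin, where `f` is at most C/R².
  have hbound : ∀ R : ℝ, 0 < R → ‖∫ x in -R..id R, f x‖ ≤ 4 * C / R := by
    intro R hR
    have key := Complex.integral_boundary_rect_eq_zero_of_differentiableOn f
      (⟨-R, 0⟩ : ℂ) (⟨R, R⟩ : ℂ) (by
        intro z hz
        refine (hd z ?_).differentiableWithinAt
        have h2 := hz.2
        simp only [mem_preimage] at h2
        rw [uIcc_of_le hR.le] at h2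
        exact h2.1)
    have hfar : ∀ z : ℂ, 0 ≤ z.im → R ≤ ‖z‖ → ‖f z‖ ≤ C / R ^ 2 := by
      intro z hz hz2
      refine (hC z hz).trans ?_
      gcongr
      linarith
    have b1 : ‖∫ x in -R..R, f (x + R * Complex.I)‖ ≤ C / R ^ 2 * |R - -R| := by
      refine intervalIntegral.norm_integral_le_of_norm_le_const fun x _ => hfar _ ?_ ?_
      · simp [hR.le]
      · refine le_trans ?_ (Complex.abs_im_le_norm _)
        simp [le_abs_self]
    have b2 : ‖∫ y in (0 : ℝ)..R, f (R + y * Complex.I)‖ ≤ C / R ^ 2 * |R - 0| := by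
      refine intervalIntegral.norm_integral_le_of_norm_le_const fun y hy => hfar _ ?_ ?_
      · rw [uIoc_of_le hR.le] at hy
        simp [hy.1.le]
      · refine le_trans ?_ (Complex.abs_re_le_norm _)
        simp [le_abs_self]
    have b3 : ‖∫ y in (0 : ℝ)..R, f ((-R : ℝ) + y * Complex.I)‖ ≤ C / R ^ 2 * |R - 0| := by
      refine intervalIntegral.norm_integral_le_of_norm_le_const fun y hy => hfar _ ?_ ?_
      · rw [uIoc_of_le hR.le] at hy
        simp [hy.1.le]
      · refine le_trans ?_ (Complex.abs_re_le_norm _)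
        simp [le_abs_self]
    have e0 : (∫ x in -R..id R, f x) = (∫ x in -R..R, f (x + R * Complex.I))
        - Complex.I * (∫ y in (0 : ℝ)..R, f (R + y * Complex.I))
        + Complex.I * (∫ y in (0 : ℝ)..R, f ((-R : ℝ) + y * Complex.I)) := by
      simp only [Complex.ofReal_zero, zero_mul, add_zero, smul_eq_mul] at key
      simp only [id]
      linear_combination key
    rw [e0]
    rw [show R - -R = 2 * R by ring, abs_of_pos (by positivity)] at b1
    rw [sub_zero, abs_of_pos hR] at b2 b3
    have : 4 * C / R = C / R ^ 2 * (2 * R) + C / R ^ 2 * R + C / R ^ 2 * R := by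
      field_simp
      ring
    rw [this]
    refine (norm_add_le _ _).trans (add_le_add ((norm_sub_le _ _).trans (add_le_add b1 ?_)) ?_)
    · simpa using b2
    · simpa using b3
  refine squeeze_zero_norm' (a := fun R => 4 * C / R) ?_ ?_
  · filter_upwards [eventually_gt_atTop 0] with R hR using hbound R hR
  · exact tendsto_const_nhds.div_atTop tendsto_id

/-- A linear form in `z` whose zero lies in the lower half plane is bounded below by a multiple
of `1 + |z|` in the upper half plane. -/
theorem exists_one_add_norm_le_of_im (P : ℂ) (q c : ℝ) (h : c * P.im < 0) :
    ∃ K : ℝ, 0 < K ∧ ∀ z : ℂ, 0 ≤ z.im → (q + c * z - P ≠ 0) ∧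
      ‖(1 : ℂ) / (q + c * z - P)‖ ≤ K * (1 + ‖z‖)⁻¹ := by
  have hc : c ≠ 0 := by rintro rfl; simp at h
  have hP : P.im ≠ 0 := by intro h0; simp [h0] at h
  have hc' := abs_pos.2 hc
  have hP' := abs_pos.2 hP
  -- With w the linear form, |c||z| ≤ |w| + |P - q| bounds |z|, and |w| ≥ |Im P| turns the constants
  -- left over into multiples of |w|.
  refine ⟨1 / |c| + (1 + ‖P - q‖ / |c|) / |P.im|, by positivity, fun z hz => ?_⟩
  set w : ℂ := q + c * z - P with hw
  have him : |P.im| ≤ ‖w‖ := by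
    refine le_trans ?_ (Complex.abs_im_le_norm _)
    have : w.im = c * z.im - P.im := by simp [hw]
    rw [this]
    rcases lt_or_gt_of_ne hc with h1 | h1
    · have h2 : 0 < P.im := pos_of_mul_neg_right h h1.le
      have h3 : c * z.im ≤ 0 := mul_nonpos_of_nonpos_of_nonneg h1.le hz
      rw [abs_of_pos h2, abs_of_nonpos (by linarith)]
      linarith
    · have h2 : P.im < 0 := neg_of_mul_neg_right h h1.le
      have h3 : 0 ≤ c * z.im := mul_nonneg h1.le hz
      rw [abs_of_neg h2, abs_of_nonneg (by linarith)]
      linarith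
  have hw0 : 0 < ‖w‖ := hP'.trans_le him
  refine ⟨norm_pos_iff.1 hw0, ?_⟩
  have h1 : |c| * ‖z‖ ≤ ‖w‖ + ‖P - q‖ := by
    have : (c : ℂ) * z = w + (P - q) := by rw [hw]; ring
    calc |c| * ‖z‖ = ‖(c : ℂ) * z‖ := by simp
      _ ≤ _ := by rw [this]; exact norm_add_le _ _
  have h2 : ‖z‖ ≤ (‖w‖ + ‖P - q‖) / |c| := by
    rw [le_div_iff₀ hc']; linarith
  have h3 : 1 + ‖P - q‖ / |c| ≤ (1 + ‖P - q‖ / |c|) / |P.im| * ‖w‖ := by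
    rw [div_mul_eq_mul_div, le_div_iff₀ hP']
    gcongr
  rw [norm_div, norm_one, ← div_eq_mul_inv, div_le_div_iff₀ hw0 (by positivity)]
  have : (‖w‖ + ‖P - q‖) / |c| = 1 / |c| * ‖w‖ + ‖P - q‖ / |c| := by ring
  rw [add_mul]
  linarith

/-- A product of simple fractions with at least two poles, all in the lower half plane,
integrates to zero. -/
theorem integral_prod_simple_fractions {J : Type*} [Fintype J] [DecidableEq J] (P : J → ℂ) (q c : J → ℝ)
    (hP : ∀ j, (P j).im ≠ 0) (hc : ∀ j, c j = 0 ∨ c j * (P j).im < 0)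
    {a b : J} (hab : a ≠ b) (ha : c a ≠ 0) (hb : c b ≠ 0) :
    Integrable (fun x : ℝ => ∏ j, (1 : ℂ) / (((q j + c j * x : ℝ) : ℂ) - P j)) ∧
      ∫ x : ℝ, ∏ j, (1 : ℂ) / (((q j + c j * x : ℝ) : ℂ) - P j) = 0 := by
  have hK : ∀ j, ∃ K : ℝ, 0 < K ∧ ∀ z : ℂ, 0 ≤ z.im → (q j + c j * z - P j ≠ 0) ∧
      ‖(1 : ℂ) / (q j + c j * z - P j)‖ ≤ K * (if c j = 0 then 1 else (1 + ‖z‖)⁻¹) := by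
    intro j
    rcases eq_or_ne (c j) 0 with h0 | h0
    · have hne : (q j : ℂ) - P j ≠ 0 := by
        intro h
        have := congrArg Complex.im h
        simp at this
        exact hP j this
      exact ⟨‖(1 : ℂ) / (q j - P j)‖, by simpa using hne, fun z _ => by simp [h0, hne]⟩
    · obtain ⟨K, hK, h⟩ := exists_one_add_norm_le_of_im (P j) (q j) (c j) ((hc j).resolve_left h0)
      exact ⟨K, hK, by simpa [h0] using h⟩
  choose K hK0 hK using hK
  have key := integral_eq_zero_of_differentiableAt_upper
    (fun z => ∏ j, (1 : ℂ) / (q j + c j * z - P j)) (∏ j, K j) (fun z hz => by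
      refine DifferentiableAt.fun_finsetProd fun j _ => ?_
      exact DifferentiableAt.div (by fun_prop) (by fun_prop) (hK j z hz).1) (fun z hz => by
      rw [norm_prod]
      refine (Finset.prod_le_prod (fun _ _ => norm_nonneg _) fun j _ => (hK j z hz).2).trans ?_
      rw [Finset.prod_mul_distrib, div_eq_mul_inv]
      refine mul_le_mul_of_nonneg_left ?_ (Finset.prod_nonneg fun j _ => (hK0 j).le)
      have h01 : (1 + ‖z‖)⁻¹ ≤ 1 := inv_le_one_of_one_le₀ (by linarith [norm_nonneg z])
      have h00 : 0 ≤ (1 + ‖z‖)⁻¹ := by positivity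
      -- The factors `a` and `b` supply the quadratic decay; all others are at most 1.
      rw [← Finset.mul_prod_erase _ _ (Finset.mem_univ a),
        ← Finset.mul_prod_erase _ _ (Finset.mem_erase.2 ⟨hab.symm, Finset.mem_univ b⟩), if_neg ha,
        if_neg hb, ← mul_assoc, ← inv_pow, ← sq]
      refine mul_le_of_le_one_right (by positivity) (Finset.prod_le_one (fun j _ => ?_) fun j _ => ?_)
      · split_ifs <;> positivity
      · split_ifs
        · exact le_rfl
        · exact h01)
  simpa using key

/-! ### Frequencies and polar numbers -/

theorem frequency_sq_mem_slitPlane {ε m r : ℝ} (h : 0 < ε ∨ m ≠ 0) :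
    (r : ℂ) ^ 2 + (m : ℂ) ^ 2 - Complex.I * (ε : ℂ) ∈ Complex.slitPlane := by
  rw [Complex.mem_slitPlane_iff]
  rcases h with h | h
  · right
    simp [← Complex.ofReal_pow, h.ne']
  · left
    simp [← Complex.ofReal_pow]
    positivity

/-- The radicand lies in the open lower half plane, so halving its argument puts the root in the
open fourth quadrant. -/
theorem frequency_re_im {ε m r : ℝ} (h : 0 < ε) :
    0 < (frequency ε m r).re ∧ (frequency ε m r).im < 0 := by
  set c : ℂ := (r : ℂ) ^ 2 + (m : ℂ) ^ 2 - Complex.I * (ε : ℂ) with hc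
  have hs := frequency_sq_mem_slitPlane (m := m) (r := r) (Or.inl h)
  rw [← hc] at hs
  have hc0 : c ≠ 0 := Complex.slitPlane_ne_zero hs
  have him : c.im < 0 := by simp [hc, ← Complex.ofReal_pow, h]
  have harg : c.arg < 0 := Complex.arg_neg_iff.2 him
  have harg2 := Complex.neg_pi_lt_arg c
  have e : frequency ε m r = Complex.exp (Complex.log c * (1 / 2)) := by
    rw [frequency, ← hc, Complex.cpow_def_of_ne_zero hc0]
  have eim : (Complex.log c * (1 / 2)).im = c.arg / 2 := by
    rw [show (1 / 2 : ℂ) = ((1 / 2 : ℝ) : ℂ) by simp, Complex.im_mul_ofReal, Complex.log_im]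
    ring
  rw [e, Complex.exp_re, Complex.exp_im, eim]
  have hpi := Real.pi_pos
  constructor
  · refine mul_pos (Real.exp_pos _) (Real.cos_pos_of_mem_Ioo ⟨by linarith, by linarith⟩)
  · refine mul_neg_of_pos_of_neg (Real.exp_pos _) (Real.sin_neg_of_neg_of_neg_pi_lt (by linarith)
      (by linarith))

theorem continuous_frequency {ε m : ℝ} (h : 0 < ε) : Continuous (frequency ε m) := by
  unfold frequency
  exact Continuous.cpow (by fun_prop) continuous_const
    fun r => frequency_sq_mem_slitPlane (Or.inl h)

/-- The pole of the polar number. -/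
noncomputable def polarPole (ω : ℂ) (isTau : Bool) (s : ℤˣ) : ℂ :=
  if isTau then -((s : ℤ) : ℂ) * conj ω else ((s : ℤ) : ℂ) * ω

/-- The residue of the polar number at its pole. -/
noncomputable def polarResidue (ω : ℂ) (isTau : Bool) (s : ℤˣ) : ℂ :=
  ((s : ℤ) : ℂ) * (1 / (2 * if isTau then conj ω else ω))

theorem polarNumber_eq (ω : ℂ) (isTau : Bool) (s : ℤˣ) (k0 : ℝ) :
    polarNumber ω isTau s k0 = polarResidue ω isTau s * (1 / ((k0 : ℂ) - polarPole ω isTau s)) := by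
  cases isTau
  · simp [polarNumber, polarResidue, polarPole, polarSigma]
  · simp [polarNumber, polarResidue, polarPole, polarSigma, polarTau, Complex.conj_ofNat]

/-- The reason for the sign conventions of τ: conjugation and reversal of polarity compensate each
other, so that the polarity alone, not the marking, decides on which side of the real line the pole
lies. -/
theorem polarPole_im (ω : ℂ) (isTau : Bool) (s : ℤˣ) :
    (polarPole ω isTau s).im = ((s : ℤ) : ℝ) * ω.im := by
  cases isTau
  · simp [polarPole]
  · simp [polarPole]

theorem abs_unit_cast (s : ℤˣ) : |((s : ℤ) : ℝ)| = 1 := by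
  rcases Int.units_eq_one_or s with rfl | rfl <;> simp

theorem polarPole_im_ne_zero {ω : ℂ} (h : ω.im ≠ 0) (isTau : Bool) (s : ℤˣ) :
    (polarPole ω isTau s).im ≠ 0 := by
  rw [polarPole_im]
  refine mul_ne_zero ?_ h
  simp

theorem norm_polarPole (ω : ℂ) (isTau : Bool) (s : ℤˣ) : ‖polarPole ω isTau s‖ = ‖ω‖ := by
  rcases Int.units_eq_one_or s with rfl | rfl <;> cases isTau <;> simp [polarPole]

theorem norm_polarResidue (ω : ℂ) (isTau : Bool) (s : ℤˣ) :
    ‖polarResidue ω isTau s‖ = 1 / (2 * ‖ω‖) := by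
  rcases Int.units_eq_one_or s with rfl | rfl <;> cases isTau <;> simp [polarResidue]

theorem ofReal_sub_ne_zero {P : ℂ} (h : P.im ≠ 0) (x : ℝ) : (x : ℂ) - P ≠ 0 := by
  intro h0
  have := congrArg Complex.im h0
  simp at this
  exact h this

theorem one_div_ofReal_sub_le {P : ℂ} (h : P.im ≠ 0) (x : ℝ) :
    ‖(1 : ℂ) / ((x : ℂ) - P)‖ ≤ (1 + (1 + ‖P‖) / |P.im|) * (1 + |x|)⁻¹ := by
  have hP := abs_pos.2 h
  have h1 : |P.im| ≤ ‖(x : ℂ) - P‖ := by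
    refine le_trans ?_ (Complex.abs_im_le_norm _)
    simp
  have h2 : |x| ≤ ‖(x : ℂ) - P‖ + ‖P‖ := by
    calc |x| = ‖((x : ℂ) - P) + P‖ := by simp
      _ ≤ _ := norm_add_le _ _
  have h3 : 1 + ‖P‖ ≤ (1 + ‖P‖) / |P.im| * ‖(x : ℂ) - P‖ := by
    rw [div_mul_eq_mul_div, le_div_iff₀ hP]
    gcongr
  rw [norm_div, norm_one, ← div_eq_mul_inv, div_le_div_iff₀ (hP.trans_le h1) (by positivity), add_mul]
  linarith

/-- A constant that controls the decay of the simple fractions with poles at `±ω` and `±ω^*`. -/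
noncomputable def decayConst (ω : ℂ) : ℝ := 1 + (1 + ‖ω‖) / |ω.im|

theorem one_div_sub_polarPole_le {ω : ℂ} (h : ω.im ≠ 0) (isTau : Bool) (s : ℤˣ) (x : ℝ) :
    ‖(1 : ℂ) / ((x : ℂ) - polarPole ω isTau s)‖ ≤ decayConst ω * (1 + |x|)⁻¹ := by
  have := one_div_ofReal_sub_le (polarPole_im_ne_zero h isTau s) x
  rwa [norm_polarPole, polarPole_im, abs_mul, abs_unit_cast, one_mul] at this

theorem norm_polarNumber_le {ω : ℂ} (h : ω.im ≠ 0) (isTau : Bool) (s : ℤˣ) (x : ℝ) :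
    ‖polarNumber ω isTau s x‖ ≤ 1 / (2 * ‖ω‖) * decayConst ω * (1 + |x|)⁻¹ := by
  rw [polarNumber_eq, norm_mul, norm_polarResidue, mul_assoc]
  exact mul_le_mul_of_nonneg_left (one_div_sub_polarPole_le h isTau s x) (by positivity)

/-- The four propagators become one formula in which each polarity refers to the mark of one end
only. The combinatorics of the cutting equation rests on this. -/
theorem propagator_eq (ω : ℂ) (a b : Bool) (x : ℝ) :
    propagator ω a b x = polarNumber ω a 1 x + polarNumber ω b (-1) x := by
  cases a <;> cases b <;> simp [propagator, polarNumber, add_comm]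

theorem norm_propagator_le {ω : ℂ} (h : ω.im ≠ 0) (a b : Bool) (x : ℝ) :
    ‖propagator ω a b x‖ ≤ 1 / ‖ω‖ * decayConst ω * (1 + |x|)⁻¹ := by
  rw [propagator_eq]
  refine (norm_add_le _ _).trans ((add_le_add (norm_polarNumber_le h _ _ _)
    (norm_polarNumber_le h _ _ _)).trans (le_of_eq ?_))
  field_simp
  ring

/-- The two residues are opposite, so the 1/k⁰ tails cancel. The resulting quadratic decay makes
tadpole energy integrals converge absolutely. -/
theorem propagator_self_eq {ω : ℂ} (h : ω.im ≠ 0) (a : Bool) (x : ℝ) :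
    propagator ω a a x = (if a then -1 else 1) * (1 / ((x : ℂ) - polarPole ω a 1) *
      (1 / ((x : ℂ) - polarPole ω a (-1)))) := by
  have h1 := ofReal_sub_ne_zero (polarPole_im_ne_zero h a 1) x
  have h2 := ofReal_sub_ne_zero (polarPole_im_ne_zero h a (-1)) x
  rw [propagator_eq, polarNumber_eq, polarNumber_eq]
  have hω : ω ≠ 0 := by rintro rfl; simp at h
  cases a
  · simp only [polarPole, polarResidue] at *
    simp at *
    field_simp
    ring
  · simp only [polarPole, polarResidue] at *
    simp at *
    have hω' : conj ω ≠ 0 := by simpa using hω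
    field_simp
    ring

theorem norm_propagator_self_le {ω : ℂ} (h : ω.im ≠ 0) (a : Bool) (x : ℝ) :
    ‖propagator ω a a x‖ ≤ decayConst ω ^ 2 * ((1 + |x|)⁻¹ * (1 + |x|)⁻¹) := by
  rw [propagator_self_eq h, norm_mul, norm_mul]
  have h1 := one_div_sub_polarPole_le h a 1 x
  have h2 := one_div_sub_polarPole_le h a (-1) x
  have : ‖(if a then -1 else 1 : ℂ)‖ = 1 := by cases a <;> simp
  rw [this, one_mul]
  refine (mul_le_mul h1 h2 (norm_nonneg _) ((norm_nonneg _).trans h1)).trans (le_of_eq (by ring))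

theorem continuous_polarNumber {X : Type*} [TopologicalSpace X] {ω : X → ℂ} {k : X → ℝ}
    (hω : Continuous ω) (hk : Continuous k) (h : ∀ x, (ω x).im ≠ 0) (isTau : Bool) (s : ℤˣ) :
    Continuous fun x => polarNumber (ω x) isTau s (k x) := by
  have h0 : ∀ x, ω x ≠ 0 := fun x h1 => h x (by simp [h1])
  simp only [polarNumber_eq]
  refine Continuous.mul ?_ (Continuous.div continuous_const ?_ fun x =>
    ofReal_sub_ne_zero (polarPole_im_ne_zero (h x) _ _) _)
  · cases isTau
    · simp only [polarResidue, Bool.false_eq_true, if_false]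
      exact continuous_const.mul (continuous_const.div (by fun_prop) fun x => by simpa using h0 x)
    · simp only [polarResidue, if_true]
      exact continuous_const.mul (continuous_const.div (by fun_prop) fun x => by simpa using h0 x)
  · cases isTau
    · simp only [polarPole, Bool.false_eq_true, if_false]; fun_prop
    · simp only [polarPole, if_true]; fun_prop

theorem continuous_propagator {X : Type*} [TopologicalSpace X] {ω : X → ℂ} {k : X → ℝ}
    (hω : Continuous ω) (hk : Continuous k) (h : ∀ x, (ω x).im ≠ 0) (a b : Bool) :
    Continuous fun x => propagator (ω x) a b (k x) := by
  simp only [propagator_eq]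
  exact (continuous_polarNumber hω hk h _ _).add (continuous_polarNumber hω hk h _ _)

/-- The energy integral of a tadpole leg. -/
theorem integral_propagator_self {ω : ℂ} (hre : 0 < ω.re) (him : ω.im < 0) (a : Bool) :
    ∫ x : ℝ, Complex.I * propagator ω a a x = Real.pi / (if a then conj ω else ω) := by
  have hω : ω ≠ 0 := by rintro rfl; simp at him
  have upper : ∀ P Q : ℂ, P.im < 0 → Q.im < 0 →
      Integrable (fun x : ℝ => 1 / ((x : ℂ) - P) * (1 / ((x : ℂ) - Q))) ∧
      ∫ x : ℝ, 1 / ((x : ℂ) - P) * (1 / ((x : ℂ) - Q)) = 0 := by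
    intro P Q hP hQ
    have := integral_prod_simple_fractions (J := Fin 2) ![P, Q] (fun _ => 0) (fun _ => 1)
      (by simp [Fin.forall_fin_two, hP.ne, hQ.ne]) (by simp [Fin.forall_fin_two, hP, hQ])
      (a := 0) (b := 1) (by simp) (by simp) (by simp)
    simpa [Fin.prod_univ_two, mul_inv, -mul_inv_rev] using this
  have lower : ∀ P Q : ℂ, 0 < P.im → 0 < Q.im →
      Integrable (fun x : ℝ => 1 / ((x : ℂ) - P) * (1 / ((x : ℂ) - Q))) ∧
      ∫ x : ℝ, 1 / ((x : ℂ) - P) * (1 / ((x : ℂ) - Q)) = 0 := by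
    intro P Q hP hQ
    have := upper (-P) (-Q) (by simpa) (by simpa)
    have e : ∀ x : ℝ, 1 / ((x : ℂ) - P) * (1 / ((x : ℂ) - Q)) =
        1 / (((-x : ℝ) : ℂ) - -P) * (1 / (((-x : ℝ) : ℂ) - -Q)) := by
      intro x
      have h1 := ofReal_sub_ne_zero hP.ne' x
      have h2 := ofReal_sub_ne_zero hQ.ne' x
      have h3 : ((-x : ℝ) : ℂ) - -P = -((x : ℂ) - P) := by push_cast; ring
      have h4 : ((-x : ℝ) : ℂ) - -Q = -((x : ℂ) - Q) := by push_cast; ring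
      rw [h3, h4]
      field_simp
    simp_rw [e]
    refine ⟨this.1.comp_neg, ?_⟩
    rw [integral_neg_eq_self (fun x : ℝ => 1 / ((x : ℂ) - -P) * (1 / ((x : ℂ) - -Q)))]
    exact this.2
  obtain ⟨i1, e1⟩ := upper (polarPole ω a 1) (-Complex.I) (by rw [polarPole_im]; simpa) (by simp)
  obtain ⟨i2, e2⟩ := lower (polarPole ω a (-1)) Complex.I (by rw [polarPole_im]; simpa) (by simp)
  have i3 : Integrable (fun x : ℝ => ((1 + x ^ 2)⁻¹ : ℝ)) := integrable_inv_one_add_sq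
  have e3 : ∫ x : ℝ, (((1 + x ^ 2)⁻¹ : ℝ) : ℂ) = Real.pi := by
    rw [integral_complex_ofReal, integral_univ_inv_one_add_sq]
  set ω' : ℂ := if a then conj ω else ω with hω'
  have hω0 : ω' ≠ 0 := by cases a <;> simp [hω', hω]
  -- Each pole is exchanged for the pole ∓i on its own side of the real line. The corrections have
  -- both poles on one side and integrate to zero; what remains is a multiple of 1/(1 + x²), with
  -- integral π.
  have hfun : (fun x : ℝ => Complex.I * propagator ω a a x) = fun x : ℝ =>
      Complex.I / (2 * ω') * ((polarPole ω a 1 + Complex.I) * (1 / ((x : ℂ) - polarPole ω a 1) *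
        (1 / ((x : ℂ) - -Complex.I))) - (polarPole ω a (-1) - Complex.I) *
        (1 / ((x : ℂ) - polarPole ω a (-1)) * (1 / ((x : ℂ) - Complex.I)))
        - 2 * Complex.I * (((1 + x ^ 2)⁻¹ : ℝ) : ℂ)) := by
    funext x
    have h1 := ofReal_sub_ne_zero (polarPole_im_ne_zero him.ne a 1) x
    have h2 := ofReal_sub_ne_zero (polarPole_im_ne_zero him.ne a (-1)) x
    have h3 : (x : ℂ) - -Complex.I ≠ 0 := ofReal_sub_ne_zero (by simp) x
    have h4 : (x : ℂ) - Complex.I ≠ 0 := ofReal_sub_ne_zero (by simp) x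
    have h5 : ((1 + x ^ 2)⁻¹ : ℝ) = 1 / ((x : ℂ) - -Complex.I) * (1 / ((x : ℂ) - Complex.I)) := by
      rw [one_div_mul_one_div, one_div]
      push_cast
      congr 1
      ring_nf
      simp
      ring
    have r1 : polarResidue ω a 1 = 1 / (2 * ω') := by simp [polarResidue, hω']
    have r2 : polarResidue ω a (-1) = -(1 / (2 * ω')) := by simp [polarResidue, hω']
    rw [propagator_eq, polarNumber_eq, polarNumber_eq, r1, r2, h5]
    field_simp
    ring
  rw [hfun, integral_const_mul, integral_sub, integral_sub, integral_const_mul, integral_const_mul,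
    integral_const_mul, e1, e2, e3]
  · field_simp
    linear_combination (-2 * Real.pi : ℂ) * Complex.I_sq
  · exact i1.const_mul _
  · exact i2.const_mul _
  · exact (i1.const_mul _).sub (i2.const_mul _)
  · exact (i3.ofReal).const_mul _

/-! ### Integration over spaces of flows -/

section ChangeOfVariables

variable {X Y : Type*} [NormedAddCommGroup X] [NormedSpace ℝ X]
    [MeasureSpace X] [BorelSpace X] [(volume : Measure X).IsAddHaarMeasure]
    [NormedAddCommGroup Y] [NormedSpace ℝ Y]
    [MeasureSpace Y] [BorelSpace Y] [FiniteDimensional ℝ Y] [(volume : Measure Y).IsAddHaarMeasure]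

theorem ContinuousLinearEquiv.exists_volume_eq_smul_map (T : X ≃L[ℝ] Y) :
    ∃ c : NNReal, c ≠ 0 ∧ (volume : Measure Y) = c • Measure.map T (volume : Measure X) := by
  have hH : (Measure.map T (volume : Measure X)).IsAddHaarMeasure := inferInstance
  have h := Measure.isAddLeftInvariant_eq_smul (volume : Measure Y) (Measure.map T (volume : Measure X))
  refine ⟨_, fun h0 => ?_, h⟩
  rw [h0, zero_smul] at h
  have := (inferInstance : (volume : Measure Y).IsAddHaarMeasure).toIsOpenPosMeasure.open_pos
    univ isOpen_univ ⟨0, mem_univ _⟩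
  simp [h] at this

theorem ContinuousLinearEquiv.integrable_comp_volume_iff {F : Type*} [NormedAddCommGroup F] (T : X ≃L[ℝ] Y)
    (f : Y → F) : Integrable (fun x => f (T x)) ↔ Integrable f := by
  obtain ⟨c, hc0, h⟩ := T.exists_volume_eq_smul_map
  have hemb : MeasurableEmbedding T := T.toHomeomorph.measurableEmbedding
  have e : Integrable f ↔ Integrable f ((c : ENNReal) • Measure.map T (volume : Measure X)) := by
    rw [h]; rfl
  rw [e, integrable_smul_measure (by simpa using hc0) (by simp), hemb.integrable_map_iff]
  rfl

/-- The value of the Jacobian is irrelevant; it matters that `c` does not depend on `f`, hence is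
the same for all markings. -/
theorem ContinuousLinearEquiv.exists_integral_eq_mul (T : X ≃L[ℝ] Y) :
    ∃ c : ℂ, ∀ f : Y → ℂ, ∫ y, f y = c * ∫ x, f (T x) := by
  obtain ⟨c, hc0, h⟩ := T.exists_volume_eq_smul_map
  have hemb : MeasurableEmbedding T := T.toHomeomorph.measurableEmbedding
  refine ⟨c, fun f => ?_⟩
  rw [h, integral_smul_nnreal_measure, hemb.integral_map]
  rfl

end ChangeOfVariables

theorem isAddHaarMeasure_volume_prod (X Y : Type*) [NormedAddCommGroup X] [NormedSpace ℝ X]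
    [FiniteDimensional ℝ X] [MeasureSpace X] [BorelSpace X] [(volume : Measure X).IsAddHaarMeasure]
    [NormedAddCommGroup Y] [NormedSpace ℝ Y] [FiniteDimensional ℝ Y] [MeasureSpace Y] [BorelSpace Y]
    [(volume : Measure Y).IsAddHaarMeasure] : (volume : Measure (X × Y)).IsAddHaarMeasure :=
  inferInstanceAs ((volume : Measure X).prod (volume : Measure Y)).IsAddHaarMeasure

/-- A function on a coordinate space integrates to zero if it does so along all parallels to a
fixed direction. -/
theorem integral_eq_zero_of_forall_line {ι : Type*} [Fintype ι] {F : (ι → ℝ) → ℂ}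
    (hF : Integrable F) {n : ι → ℝ} (hn : n ≠ 0)
    (h : ∀ x, ∫ t : ℝ, F (x + t • n) = 0) : ∫ x, F x = 0 := by
  classical
  obtain ⟨j, hj⟩ := Function.ne_iff.1 hn
  -- The hyperplane x_j = 0 is transversal to `n`, as n_j ≠ 0. It and the line spanned by `n` give
  -- coordinates for Fubini.
  let S : ({i // i ≠ j} → ℝ) →ₗ[ℝ] (ι → ℝ) := Function.ExtendByZero.linearMap ℝ Subtype.val
  have hSj : ∀ y, S y j = 0 := fun y =>
    Function.extend_apply' _ _ _ (by rintro ⟨a, ha⟩; exact a.2 ha)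
  have hSi : ∀ y (i : {i // i ≠ j}), S y i = y i := fun y i =>
    Subtype.val_injective.extend_apply y 0 i
  let T : (({i // i ≠ j} → ℝ) × ℝ) →ₗ[ℝ] (ι → ℝ) :=
    S.coprod (LinearMap.toSpanSingleton ℝ (ι → ℝ) n)
  have hT : ∀ p, T p = S p.1 + p.2 • n := fun p => by simp [T]
  have hinj : Function.Injective T := by
    rw [← LinearMap.ker_eq_bot, LinearMap.ker_eq_bot']
    rintro ⟨y, t⟩ h0
    rw [hT] at h0
    have h1 := congrFun h0 j
    simp only [Pi.add_apply, hSj, Pi.smul_apply, smul_eq_mul, zero_add, Pi.zero_apply] at h1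
    have ht : t = 0 := (mul_eq_zero.1 h1).resolve_right hj
    subst ht
    ext i
    · have := congrFun h0 i
      simpa [hSi] using this
    · rfl
  have hdim : Module.finrank ℝ (({i // i ≠ j} → ℝ) × ℝ) = Module.finrank ℝ (ι → ℝ) := by
    have : 0 < Fintype.card ι := Fintype.card_pos_iff.2 ⟨j⟩
    simp [Fintype.card_subtype_compl]
    omega
  let e : (({i // i ≠ j} → ℝ) × ℝ) ≃L[ℝ] (ι → ℝ) :=
    (LinearEquiv.ofInjectiveOfFinrankEq T hinj hdim).toContinuousLinearEquiv
  have he : ∀ p, e p = S p.1 + p.2 • n := hT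
  have := isAddHaarMeasure_volume_prod ({i // i ≠ j} → ℝ) ℝ
  obtain ⟨c, hc⟩ := e.exists_integral_eq_mul
  have hint := (e.integrable_comp_volume_iff F).2 hF
  rw [hc, Measure.volume_eq_prod, integral_prod _ hint]
  simp [he, h]

/-- From finitely many linear functionals that separate the points of a coordinate space one can
select coordinates. -/
theorem exists_coordinates {ι J : Type*} [Fintype ι] [Finite J] (l : J → (ι → ℝ) →ₗ[ℝ] ℝ)
    (h : ∀ e, (∀ j, l j e = 0) → e = 0) :
    ∃ (B : ι → J) (T : (ι → ℝ) ≃L[ℝ] (ι → ℝ)), Function.Injective B ∧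
      ∀ e a, T e a = l (B a) e := by
  classical
  obtain ⟨κ, a, ha, hspan, hli⟩ := exists_linearIndependent' ℝ l
  -- Separating points means that the span of the functionals has zero common kernel, hence is the
  -- whole dual; an independent subfamily with the same span is then a basis.
  have htop : Submodule.span ℝ (range l) = ⊤ := by
    have h1 : (Submodule.span ℝ (range l)).dualCoannihilator = ⊥ := by
      rw [eq_bot_iff]
      intro e he
      rw [Submodule.mem_dualCoannihilator] at he
      exact h e fun j => he _ (Submodule.subset_span ⟨j, rfl⟩)
    have h2 := Subspace.dualCoannihilator_dualAnnihilator_eq (W := Submodule.span ℝ (range l))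
    rw [← h2, h1, Submodule.dualAnnihilator_bot]
  let bb : Module.Basis κ ℝ (Module.Dual ℝ (ι → ℝ)) := Module.Basis.mk hli (by rw [hspan, htop])
  have : Finite κ := Finite.of_injective a ha
  have : Fintype κ := Fintype.ofFinite κ
  have hcard : Fintype.card ι = Fintype.card κ := by
    rw [← Module.finrank_eq_card_basis bb, Subspace.dual_finrank_eq, Module.finrank_fintype_fun_eq_card]
  let σ : ι ≃ κ := Fintype.equivOfCardEq hcard
  let T : (ι → ℝ) →ₗ[ℝ] (ι → ℝ) := LinearMap.pi fun i => l (a (σ i))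
  have hT : Function.Injective T := by
    rw [← LinearMap.ker_eq_bot, LinearMap.ker_eq_bot']
    intro e he
    have h0 : ∀ k, l (a k) e = 0 := fun k => by
      have := congrFun he (σ.symm k)
      simpa [T] using this
    refine (Module.forall_dual_apply_eq_zero_iff ℝ e).1 fun φ => ?_
    rw [← bb.sum_repr φ]
    simp [bb, h0]
  exact ⟨fun i => a (σ i), (LinearEquiv.ofInjectiveEndo T hT).toContinuousLinearEquiv,
    ha.comp σ.injective, fun e i => rfl⟩

/-- Power counting: a product of factors that decay like the inverses of linear functionals is
integrable if the functionals separate points even after one of them is left out. -/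
theorem integrable_prod_inv_one_add_abs {ι J : Type*} [Fintype ι] [Fintype J] [DecidableEq J]
    (l : J → (ι → ℝ) →ₗ[ℝ] ℝ) (q : J → ℝ)
    (h0 : ∀ e, (∀ j, l j e = 0) → e = 0) (h : ∀ i e, (∀ j, j ≠ i → l j e = 0) → e = 0) :
    Integrable fun e : ι → ℝ => ∏ j, (1 + |q j + l j e|)⁻¹ := by
  rcases isEmpty_or_nonempty ι with hι | hι
  · exact Integrable.of_finite
  have hJ : Nonempty J := by
    by_contra hJ
    rw [not_nonempty_iff] at hJ
    obtain ⟨a⟩ := hι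
    have := congrFun (h0 (fun _ => 1) fun j => (hJ.false j).elim) a
    simp at this
  have hB : ∀ i, ∃ (B : ι → J) (T : (ι → ℝ) ≃L[ℝ] (ι → ℝ)), Function.Injective B ∧ (∀ a, B a ≠ i) ∧
      ∀ e a, T e a = l (B a) e := by
    intro i
    obtain ⟨B, T, hB, hT⟩ := exists_coordinates (fun j : {j // j ≠ i} => l j)
      fun e he => h i e fun j hj => he ⟨j, hj⟩
    exact ⟨fun a => B a, T, Subtype.val_injective.comp hB, fun a => (B a).2, hT⟩
  choose B T hB hBi hT using hB
  set L : ℝ := (Fintype.card ι : ℝ) with hL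
  have hL0 : 0 < L := by rw [hL]; exact_mod_cast Fintype.card_pos
  -- In the coordinates selected without using `i`, this is a product of one-variable functions of
  -- decay exponent 1 + 1/L > 1.
  have hint : ∀ i, Integrable fun e : ι → ℝ => ∏ a, (1 + |q (B i a) + l (B i a) e|) ^ (-(1 + 1 / L)) := by
    intro i
    have h1 : ∀ a, Integrable fun x : ℝ => (1 + |q (B i a) + x|) ^ (-(1 + 1 / L)) := by
      intro a
      have : Integrable fun x : ℝ => (1 + ‖x‖) ^ (-(1 + 1 / L)) := integrable_one_add_norm (by simp [hL0])
      simpa using this.comp_add_left (q (B i a))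
    have h2 := (Integrable.fintype_prod h1)
    have h3 := ((T i).integrable_comp_volume_iff _).2 h2
    simpa only [hT] using h3
  refine (integrable_finsetSum Finset.univ fun i _ => hint i).mono' ?_ (ae_of_all _ fun e => ?_)
  · refine Continuous.aestronglyMeasurable ?_
    have : ∀ j, Continuous (l j) := fun j => LinearMap.continuous_of_finiteDimensional _
    exact continuous_finsetProd _ fun j _ => Continuous.inv₀ (by fun_prop) fun e => by positivity
  set g : J → ℝ := fun j => (1 + |q j + l j e|)⁻¹ with hg
  have g0 : ∀ j, 0 < g j := fun j => by simp only [hg]; positivity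
  have g1 : ∀ j, g j ≤ 1 := fun j => inv_le_one_of_one_le₀ (by simp)
  -- The smallest factor is the surplus: it is the product of L copies of its own L-th root, and
  -- each copy is at most the L-th root of one coordinate factor, which raises the exponents from 1
  -- to 1 + 1/L. Since `i` depends on the point, the majorant is summed over all `i`.
  obtain ⟨i, hi⟩ := Finite.exists_min g
  have hsum : ∏ a, (1 + |q (B i a) + l (B i a) e|) ^ (-(1 + 1 / L)) ≤
      ∑ i, ∏ a, (1 + |q (B i a) + l (B i a) e|) ^ (-(1 + 1 / L)) :=
    Finset.single_le_sum (f := fun i => ∏ a, (1 + |q (B i a) + l (B i a) e|) ^ (-(1 + 1 / L)))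
      (fun i _ => Finset.prod_nonneg fun a _ => by positivity) (Finset.mem_univ i)
  refine le_trans ?_ hsum
  rw [Real.norm_of_nonneg (Finset.prod_nonneg fun j _ => (g0 j).le)]
  have hs : ∏ j, g j ≤ g i * ∏ a, g (B i a) := by
    have hni : i ∉ Finset.univ.image (B i) := by simp [hBi]
    have : g i * ∏ a, g (B i a) = ∏ j ∈ insert i (Finset.univ.image (B i)), g j := by
      rw [Finset.prod_insert hni, Finset.prod_image (fun _ _ _ _ h => hB i h)]
    rw [this, ← Finset.prod_mul_prod_compl (insert i (Finset.univ.image (B i))) g]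
    exact mul_le_of_le_one_right (Finset.prod_nonneg fun j _ => (g0 j).le)
      (Finset.prod_le_one (fun j _ => (g0 j).le) fun j _ => g1 j)
  refine hs.trans ?_
  have hgi : g i ≤ ∏ a, g (B i a) ^ (1 / L) := by
    calc g i = ∏ a : ι, g i ^ (1 / L) := by
          rw [Finset.prod_const, ← Real.rpow_natCast, ← Real.rpow_mul (g0 i).le, Finset.card_univ, ← hL,
            one_div_mul_cancel hL0.ne', Real.rpow_one]
      _ ≤ _ := Finset.prod_le_prod (fun a _ => Real.rpow_nonneg (g0 i).le _) fun a _ =>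
          Real.rpow_le_rpow (g0 i).le (hi _) (by positivity)
  refine (mul_le_mul_of_nonneg_right hgi (Finset.prod_nonneg fun a _ => (g0 _).le)).trans ?_
  rw [← Finset.prod_mul_distrib]
  refine le_of_eq (Finset.prod_congr rfl fun a _ => ?_)
  rw [Real.rpow_neg (by positivity), ← Real.inv_rpow (by positivity), Real.rpow_add (g0 (B i a)),
    Real.rpow_one, mul_comm]

/-! ### Flows and loops -/

namespace FeynmanDiagram

variable {V Leg X : Type*} {G : FeynmanDiagram V Leg X}

/-- Conservation at the target of `i`, where `i` enters and does not leave, leaves f i = 0 when all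
other legs carry nothing. -/
theorem closedFlows_eq_zero [DecidableEq V] [Fintype Leg] {f : Leg → ℝ} (hf : f ∈ G.closedFlows) {i : Leg} (hi : ¬ G.IsTadpole i)
    (h : ∀ j, j ≠ i → f j = 0) : f = 0 := by
  funext j
  rcases eq_or_ne j i with rfl | hj
  · have h1 := hf (G.tgt j)
    rw [Finset.sum_eq_single_of_mem j (by simp) fun k _ hk => h k hk,
      Finset.sum_eq_zero fun k hk => h k ?_] at h1
    · exact h1
    · rintro rfl
      exact hi (by simpa [IsTadpole] using hk)
  · exact h j hj

/-- The flow through the leg `i`, as a functional of the coordinates with respect to a basis of the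
closed flows. -/
noncomputable def flowCoord [DecidableEq V] [Fintype Leg] {ι : Type*} [Fintype ι] (b : Module.Basis ι ℝ G.closedFlows) (i : Leg) :
    (ι → ℝ) →ₗ[ℝ] ℝ :=
  LinearMap.proj i ∘ₗ G.closedFlows.subtype ∘ₗ b.equivFun.symm.toLinearMap

theorem flowCoord_apply [DecidableEq V] [Fintype Leg] {ι : Type*} [Fintype ι] (b : Module.Basis ι ℝ G.closedFlows) (i : Leg) (e : ι → ℝ) :
    flowCoord b i e = ∑ j, (b j : Leg → ℝ) i * e j := by
  simp [flowCoord, Module.Basis.equivFun_symm_apply, mul_comm]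

theorem flowCoord_equivFun [DecidableEq V] [Fintype Leg] {ι : Type*} [Fintype ι] (b : Module.Basis ι ℝ G.closedFlows) (i : Leg)
    (f : G.closedFlows) : flowCoord b i (b.equivFun f) = (f : Leg → ℝ) i := by
  simp [flowCoord]

theorem eq_zero_of_flowCoord [DecidableEq V] [Fintype Leg] {ι : Type*} [Fintype ι] (b : Module.Basis ι ℝ G.closedFlows) (e : ι → ℝ)
    (h : ∀ j, flowCoord b j e = 0) : e = 0 := by
  have : b.equivFun.symm e = 0 := by
    ext j
    exact h j
  exact (LinearEquiv.map_eq_zero_iff _).1 this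

theorem eq_zero_of_flowCoord_ne [DecidableEq V] [Fintype Leg] {ι : Type*} [Fintype ι] (b : Module.Basis ι ℝ G.closedFlows) {i : Leg}
    (hi : ¬ G.IsTadpole i) (e : ι → ℝ) (h : ∀ j, j ≠ i → flowCoord b j e = 0) : e = 0 := by
  have h0 := closedFlows_eq_zero (b.equivFun.symm e).2 hi h
  exact eq_zero_of_flowCoord b e fun j => congrFun h0 j

theorem continuous_flowCoord [DecidableEq V] [Fintype Leg] {ι : Type*} [Fintype ι] (b : Module.Basis ι ℝ G.closedFlows) (i : Leg) :
    Continuous (flowCoord b i) := LinearMap.continuous_of_finiteDimensional _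

namespace Loop

variable (γ : G.Loop)

theorem flow_leg [DecidableEq Leg] (t : Fin (γ.len + 1)) : γ.flow (γ.leg t) = ((γ.dir t : ℤ) : ℝ) := by
  rw [flow, Finset.sum_eq_single t]
  · simp
  · intro u _ hu
    rw [if_neg fun h => hu (γ.leg_injective h)]
  · simp

theorem flow_eq_zero [DecidableEq Leg] {i : Leg} (h : ∀ t, γ.leg t ≠ i) : γ.flow i = 0 :=
  Finset.sum_eq_zero fun t _ => if_neg (h t)

theorem flow_mem [DecidableEq V] [Fintype Leg] [DecidableEq Leg] : γ.flow ∈ G.closedFlows := by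
  intro v
  have key : ∀ f : Leg → V, ∑ i with f i = v, γ.flow i =
      ∑ t, if f (γ.leg t) = v then ((γ.dir t : ℤ) : ℝ) else 0 := by
    intro f
    simp only [flow]
    rw [Finset.sum_comm]
    refine Finset.sum_congr rfl fun t _ => ?_
    simp [Finset.sum_ite_eq]
  rw [key, key, ← sub_eq_zero, ← Finset.sum_sub_distrib]
  have e : ∀ t, (if G.tgt (γ.leg t) = v then ((γ.dir t : ℤ) : ℝ) else 0) -
      (if G.src (γ.leg t) = v then ((γ.dir t : ℤ) : ℝ) else 0) =
      (if γ.vert (t + 1) = v then 1 else 0) - if γ.vert t = v then 1 else 0 := by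
    intro t
    rcases Int.units_eq_one_or (γ.dir t) with h | h
    · obtain ⟨h1, h2⟩ := γ.forward t h
      simp [h, h1, h2]
    · obtain ⟨h1, h2⟩ := γ.backward t h
      rw [h1, h2, h]
      split_ifs <;> simp
  rw [Finset.sum_congr rfl fun t _ => e t, Finset.sum_sub_distrib, sub_eq_zero]
  -- The net inflow at `v` is a difference of consecutive vertex indicators, which cancels under the
  -- cyclic shift.
  exact Equiv.sum_comp (Equiv.addRight (1 : Fin (γ.len + 1))) fun t => if γ.vert t = v then (1 : ℝ) else 0

/-- A loop with a single leg is a tadpole. As `len` is one less than the number of legs, this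
provides two distinct legs and thus two poles. -/
theorem len_pos (hG : G.TadpoleFree) : 0 < γ.len := by
  rcases Nat.eq_zero_or_pos γ.len with h | h
  · exfalso
    have : Subsingleton (Fin (γ.len + 1)) := Fin.subsingleton_iff_le_one.2 (by omega)
    have h01 : (0 : Fin (γ.len + 1)) + 1 = 0 := Subsingleton.elim _ _
    refine hG (γ.leg 0) ?_
    rcases Int.units_eq_one_or (γ.dir 0) with h' | h'
    · obtain ⟨h1, h2⟩ := γ.forward 0 h'
      rw [IsTadpole, h1, h2, h01]
    · obtain ⟨h1, h2⟩ := γ.backward 0 h'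
      rw [IsTadpole, h1, h2, h01]
  · exact h

/-- Polarity and direction change sign together from leg to leg, so their product is constant along
the loop. This is the common side of all poles in the loop energy. -/
theorem Polarized.mul_dir_eq {γ : G.Loop} {s : Leg → ℤˣ} (h : γ.Polarized s) (t : Fin (γ.len + 1)) :
    s (γ.leg t) * γ.dir t = s (γ.leg 0) * γ.dir 0 := by
  induction t using Fin.induction with
  | zero => rfl
  | succ i ih =>
    rw [← ih]
    have h1 := h i.castSucc
    rw [Fin.coeSucc_eq_succ] at h1
    rcases Int.units_eq_one_or (s (γ.leg i.castSucc)) with a | a <;>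
    rcases Int.units_eq_one_or (s (γ.leg i.succ)) with b | b <;>
    rcases Int.units_eq_one_or (γ.dir i.castSucc) with c | c <;>
    rcases Int.units_eq_one_or (γ.dir i.succ) with d | d <;>
    simp [a, b, c, d] at h1 ⊢

end Loop

/-- The vertex on whose marking the polar number of polarity `s i` of the leg `i` depends. -/
def baseVertex (G : FeynmanDiagram V Leg X) (s : Leg → ℤˣ) (i : Leg) : V :=
  if s i = 1 then G.src i else G.tgt i

/-- Choose a leg based at each vertex and step to its other end; finiteness yields a periodic orbit.
Its minimal period excludes repeated vertices, and a leg has only one base vertex, so legs do not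
repeat either. -/
theorem exists_polarized_loop [Finite V] [Nonempty V] (s : Leg → ℤˣ)
    (h : ∀ v, ∃ i, G.baseVertex s i = v) : ∃ γ : G.Loop, γ.Polarized s := by
  choose g hg using h
  let next : V → V := fun v => if s (g v) = 1 then G.tgt (g v) else G.src (g v)
  obtain ⟨v⟩ := ‹Nonempty V›
  obtain ⟨a, b, hab, hne⟩ := Finite.exists_ne_map_eq_of_infinite fun n : ℕ => next^[n] v
  have hx : ∃ x, 0 < Function.minimalPeriod next x := by
    have key : ∀ a b : ℕ, a < b → next^[a] v = next^[b] v → ∃ x, 0 < Function.minimalPeriod next x := by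
      intro a b hlt he
      refine ⟨next^[a] v, Function.IsPeriodicPt.minimalPeriod_pos (n := b - a) (by omega) ?_⟩
      rw [Function.IsPeriodicPt, Function.IsFixedPt, ← Function.iterate_add_apply,
        Nat.sub_add_cancel hlt.le, he]
    rcases lt_or_gt_of_ne hab with h1 | h1
    · exact key a b h1 hne
    · exact key b a h1 hne.symm
  obtain ⟨x, hx⟩ := hx
  set p := Function.minimalPeriod next x with hp
  have hp1 : p - 1 + 1 = p := by omega
  have hinj : Function.Injective fun t : Fin (p - 1 + 1) => next^[(t : ℕ)] x := by
    intro t u htu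
    refine Fin.ext (Function.iterate_injOn_Iio_minimalPeriod ?_ ?_ htu)
    · exact mem_Iio.2 (by omega)
    · exact mem_Iio.2 (by omega)
  have hsucc : ∀ t : Fin (p - 1 + 1), next^[((t + 1 : Fin (p - 1 + 1)) : ℕ)] x = next (next^[(t : ℕ)] x) := by
    intro t
    have hmod : ∀ n : ℕ, n % (p - 1 + 1) = n % Function.minimalPeriod next x := fun n => by rw [hp1]
    rw [← Function.iterate_succ_apply' next, Fin.val_add, Fin.val_one', Nat.add_mod_mod, hmod,
      Function.iterate_mod_minimalPeriod_eq]
  have hgi : Function.Injective g := Function.LeftInverse.injective (g := G.baseVertex s) hg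
  have hgv : ∀ v, (if s (g v) = 1 then G.src (g v) else G.tgt (g v)) = v := hg
  -- A leg of polarity 1 is left from its source, one of polarity -1 from its target. Direction and
  -- polarity therefore coincide, and being polarized holds by definition.
  refine ⟨⟨p - 1, fun t => next^[(t : ℕ)] x, fun t => g (next^[(t : ℕ)] x),
    fun t => s (g (next^[(t : ℕ)] x)), hinj, hgi.comp hinj, fun t ht => ⟨?_, ?_⟩, fun t ht => ⟨?_, ?_⟩⟩,
    fun t => Iff.rfl⟩
  · have := hgv (next^[(t : ℕ)] x)
    rwa [if_pos ht] at this
  · rw [hsucc]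
    exact (if_pos ht).symm
  · rw [hsucc]
    exact (if_neg (by rw [ht]; decide)).symm
  · have := hgv (next^[(t : ℕ)] x)
    rwa [if_neg (by rw [ht]; decide)] at this

/-! ### Energy integrals -/

/-- A polarized monomial integrates to zero over the energy of its polarized loop. -/
theorem integral_polarized_loop [Fintype Leg] [DecidableEq Leg] (hG : G.TadpoleFree) {ω : Leg → ℂ} (hω : ∀ i, (ω i).im < 0)
    (isTau : Leg → Bool) (s : Leg → ℤˣ) (γ : G.Loop) (hγ : γ.Polarized s) (q : Leg → ℝ) :
    Integrable (fun e : ℝ => ∏ i, polarNumber (ω i) (isTau i) (s i) (q i + γ.flow i * e)) ∧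
      ∫ e : ℝ, ∏ i, polarNumber (ω i) (isTau i) (s i) (q i + γ.flow i * e) = 0 := by
  have hlen := γ.len_pos hG
  -- After the substitution e ↦ σe the energy enters each leg of the loop with coefficient equal to
  -- its polarity, so every pole in `e` lies in the lower half plane.
  set σ : ℤˣ := s (γ.leg 0) * γ.dir 0 with hσ
  have hc : ∀ i, ((σ : ℤ) : ℝ) * γ.flow i = 0 ∨
      ((σ : ℤ) : ℝ) * γ.flow i * (polarPole (ω i) (isTau i) (s i)).im < 0 := by
    intro i
    by_cases hi : ∃ t, γ.leg t = i
    · obtain ⟨t, rfl⟩ := hi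
      right
      have ht := hγ.mul_dir_eq t
      rw [← hσ] at ht
      rw [γ.flow_leg, polarPole_im, ← ht]
      rcases Int.units_eq_one_or (s (γ.leg t)) with a | a <;>
      rcases Int.units_eq_one_or (γ.dir t) with b | b <;> simp [a, b, hω]
    · left
      rw [γ.flow_eq_zero (by simpa using hi), mul_zero]
  have hne : ∀ t, ((σ : ℤ) : ℝ) * γ.flow (γ.leg t) ≠ 0 := by
    intro t
    rw [γ.flow_leg]
    simp
  have h01 : γ.leg 0 ≠ γ.leg (Fin.last _) := by
    intro h
    have := congrArg Fin.val (γ.leg_injective h)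
    simp at this
    omega
  have key := integral_prod_simple_fractions (fun i => polarPole (ω i) (isTau i) (s i)) q
    (fun i => ((σ : ℤ) : ℝ) * γ.flow i) (fun i => polarPole_im_ne_zero (hω i).ne _ _) hc h01 (hne _) (hne _)
  have key' : Integrable (fun e : ℝ => ∏ i, polarNumber (ω i) (isTau i) (s i)
        (q i + ((σ : ℤ) : ℝ) * γ.flow i * e)) ∧
      ∫ e : ℝ, ∏ i, polarNumber (ω i) (isTau i) (s i) (q i + ((σ : ℤ) : ℝ) * γ.flow i * e) = 0 := by
    simp only [polarNumber_eq, Finset.prod_mul_distrib]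
    refine ⟨key.1.const_mul _, ?_⟩
    rw [integral_const_mul, key.2, mul_zero]
  rcases Int.units_eq_one_or σ with h | h
  · simpa [h] using key'
  · rw [h] at key'
    have e : (fun e : ℝ => ∏ i, polarNumber (ω i) (isTau i) (s i) (q i + γ.flow i * e)) =
        fun e : ℝ => (fun e : ℝ => ∏ i, polarNumber (ω i) (isTau i) (s i)
          (q i + (((-1 : ℤˣ) : ℤ) : ℝ) * γ.flow i * e)) (-e) := by
      funext e
      simp
    rw [e]
    exact ⟨key'.1.comp_neg, (integral_neg_eq_self (fun e : ℝ => ∏ i, polarNumber (ω i) (isTau i) (s i)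
          (q i + (((-1 : ℤˣ) : ℤ) : ℝ) * γ.flow i * e)) volume).trans key'.2⟩

/-- The product of the vertex factors of a marked diagram. -/
noncomputable def vertexFactor [Fintype V] [DecidableEq V] (G : FeynmanDiagram V Leg X) (M : Finset V) : ℂ :=
  ∏ v, if v ∈ M then Complex.I * (G.coupling v : ℂ) else -(Complex.I * (G.coupling v : ℂ))

/-- Only the factor of the toggled vertex changes, from ∓iλ to ±iλ: the sign behind the pairwise
cancellation of markings. -/
theorem vertexFactor_symmDiff [Fintype V] [DecidableEq V] (M : Finset V) (v : V) :
    G.vertexFactor (symmDiff M {v}) = -G.vertexFactor M := by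
  rw [vertexFactor, vertexFactor, ← Finset.mul_prod_erase _ _ (Finset.mem_univ v),
    ← Finset.mul_prod_erase (a := v) Finset.univ (fun v => if v ∈ M then _ else _) (Finset.mem_univ v)]
  have key : ∀ a b c d : ℂ, a = -c → b = d → a * b = -(c * d) := by
    rintro a b c d rfl rfl
    rw [neg_mul]
  refine key _ _ _ _ ?_ ?_
  · by_cases h : v ∈ M <;> simp [Finset.mem_symmDiff, h]
  · refine Finset.prod_congr rfl fun u hu => ?_
    have : u ≠ v := Finset.ne_of_mem_erase hu
    simp [Finset.mem_symmDiff, this]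

variable [DecidableEq V] [Fintype Leg] [DecidableEq Leg] {ι : Type*} [Fintype ι]

/-- A single polar number decays only like 1/|k⁰|, even where a full propagator decays faster.
Absence of tadpoles provides the surplus leg that the power counting requires. -/
theorem integrable_prod_polarNumber (hG : G.TadpoleFree) {ω : Leg → ℂ} (hω : ∀ i, (ω i).im < 0)
    (b : Module.Basis ι ℝ G.closedFlows) (q : Leg → ℝ) (isTau : Leg → Bool) (s : Leg → ℤˣ) :
    Integrable fun e : ι → ℝ =>
      ∏ i, polarNumber (ω i) (isTau i) (s i) (q i + flowCoord b i e) := by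
  have h := integrable_prod_inv_one_add_abs (flowCoord b) q (eq_zero_of_flowCoord b)
    fun i e => eq_zero_of_flowCoord_ne b (hG i) e
  refine (h.const_mul (∏ i, (1 / (2 * ‖ω i‖) * decayConst (ω i)))).mono' ?_ (ae_of_all _ fun e => ?_)
  · refine Continuous.aestronglyMeasurable (continuous_finsetProd _ fun i _ => ?_)
    exact continuous_polarNumber continuous_const
      (continuous_const.add (continuous_flowCoord b i)) (fun _ => (hω i).ne) _ _
  · rw [norm_prod, ← Finset.prod_mul_distrib]
    exact Finset.prod_le_prod (fun _ _ => norm_nonneg _) fun i _ => norm_polarNumber_le (hω i).ne _ _ _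

/-- The loop is itself a closed flow, hence a direction in the space of loop energies. Integrating
along it first gives zero. -/
theorem integral_prod_polarNumber_eq_zero (hG : G.TadpoleFree) {ω : Leg → ℂ} (hω : ∀ i, (ω i).im < 0)
    (b : Module.Basis ι ℝ G.closedFlows) (q : Leg → ℝ) (isTau : Leg → Bool) (s : Leg → ℤˣ)
    (γ : G.Loop) (hγ : γ.Polarized s) :
    ∫ e : ι → ℝ, ∏ i, polarNumber (ω i) (isTau i) (s i) (q i + flowCoord b i e) = 0 := by
  refine integral_eq_zero_of_forall_line (integrable_prod_polarNumber hG hω b q isTau s)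
    (n := b.equivFun ⟨γ.flow, γ.flow_mem⟩) (fun h0 => ?_) fun x => ?_
  · have := flowCoord_equivFun b (γ.leg 0) ⟨γ.flow, γ.flow_mem⟩
    rw [h0, map_zero] at this
    change (0 : ℝ) = γ.flow (γ.leg 0) at this
    rw [γ.flow_leg] at this
    exact absurd this.symm (by simp)
  · have := (integral_polarized_loop hG hω isTau s γ hγ fun i => q i + flowCoord b i x).2
    simp only [map_add, map_smul, flowCoord_equivFun, smul_eq_mul, ← add_assoc]
    simpa only [mul_comm] using this

/-- The product of the propagators of a marked diagram, with their factors `i`. -/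
noncomputable def legFactor (G : FeynmanDiagram V Leg X) (ω : Leg → ℂ) (k : Leg → ℝ) (M : Finset V) : ℂ :=
  ∏ i, Complex.I * propagator (ω i) (decide (G.src i ∈ M)) (decide (G.tgt i ∈ M)) (k i)

/-- Distributing the product over the legs turns a choice of summands into a polarity assignment
`s`, with the marking entering through base vertices alone. -/
theorem legFactor_eq_sum (ω : Leg → ℂ) (k : Leg → ℝ) (M : Finset V) :
    G.legFactor ω k M = ∑ s : Leg → ℤˣ, Complex.I ^ Fintype.card Leg *
      ∏ i, polarNumber (ω i) (decide (G.baseVertex s i ∈ M)) (s i) (k i) := by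
  have e : ∀ i, propagator (ω i) (decide (G.src i ∈ M)) (decide (G.tgt i ∈ M)) (k i) =
      ∑ u : ℤˣ, polarNumber (ω i) (decide ((if u = 1 then G.src i else G.tgt i) ∈ M)) u (k i) := by
    intro i
    rw [propagator_eq, UnitsInt.univ, Finset.sum_pair (by decide)]
    simp
  rw [legFactor, Finset.prod_mul_distrib, Finset.prod_const, Finset.card_univ, ← Finset.mul_sum]
  congr 1
  rw [Finset.prod_congr rfl fun i _ => e i, Finset.prod_univ_sum, Fintype.piFinset_univ]
  rfl

/-- Tadpoles are allowed here: both ends of a tadpole have the same mark, so its propagator decays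
quadratically. It is counted as two factors, whence the index type `Leg ⊕ {i // G.IsTadpole i}`, and
leaving out either copy loses no information. -/
theorem integrable_legFactor {ω : Leg → ℂ} (hω : ∀ i, (ω i).im < 0)
    (b : Module.Basis ι ℝ G.closedFlows) (q : Leg → ℝ) (M : Finset V) :
    Integrable fun e : ι → ℝ => G.legFactor ω (fun i => q i + flowCoord b i e) M := by
  have h := integrable_prod_inv_one_add_abs (J := Leg ⊕ {i // G.IsTadpole i})
    (Sum.elim (flowCoord b) fun i => flowCoord b i) (Sum.elim q fun i => q i)
    (fun e he => eq_zero_of_flowCoord b e fun j => he (Sum.inl j)) (by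
      intro i e he
      rcases i with i | i
      · by_cases hi : G.IsTadpole i
        · refine eq_zero_of_flowCoord b e fun j => ?_
          rcases eq_or_ne j i with rfl | hj
          · exact he (Sum.inr ⟨j, hi⟩) (by simp)
          · exact he (Sum.inl j) (by simpa using hj)
        · exact eq_zero_of_flowCoord_ne b hi e fun j hj => he (Sum.inl j) (by simpa using hj)
      · exact eq_zero_of_flowCoord b e fun j => he (Sum.inl j) (by simp))
  have hcoef : ∀ i, ∃ C : ℝ, ∀ x : ℝ,
      ‖Complex.I * propagator (ω i) (decide (G.src i ∈ M)) (decide (G.tgt i ∈ M)) x‖ ≤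
      C * ((1 + |x|)⁻¹ * if G.IsTadpole i then (1 + |x|)⁻¹ else 1) := by
    intro i
    simp only [norm_mul, Complex.norm_I, one_mul]
    by_cases hi : G.IsTadpole i
    · refine ⟨decayConst (ω i) ^ 2, fun x => ?_⟩
      rw [if_pos hi, show G.tgt i = G.src i from hi.symm]
      exact norm_propagator_self_le (hω i).ne _ x
    · refine ⟨1 / ‖ω i‖ * decayConst (ω i), fun x => ?_⟩
      rw [if_neg hi, mul_one]
      exact norm_propagator_le (hω i).ne _ _ x
  choose C hC using hcoef
  refine (h.const_mul (∏ i, C i)).mono' ?_ (ae_of_all _ fun e => ?_)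
  · refine Continuous.aestronglyMeasurable (continuous_finsetProd _ fun i _ => ?_)
    exact continuous_const.mul (continuous_propagator continuous_const
      (continuous_const.add (continuous_flowCoord b i)) (fun _ => (hω i).ne) _ _)
  · rw [legFactor, norm_prod]
    refine (Finset.prod_le_prod (fun _ _ => norm_nonneg _) fun i _ => hC i _).trans (le_of_eq ?_)
    rw [Finset.prod_mul_distrib, Finset.prod_mul_distrib, Fintype.prod_sum_type]
    congr 2
    rw [Finset.prod_ite, Finset.prod_const_one, mul_one]
    exact (Finset.prod_subtype (F := inferInstance) (Finset.univ.filter fun i => G.IsTadpole i) (by simp)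
      fun i => (1 + |q i + flowCoord b i e|)⁻¹)

/-- With at least one vertex, `∅` and `Finset.univ` are distinct and are exactly the markings that
are not proper. -/
theorem cuttingEquation_iff {A : Type*} [AddCommGroup A] [Fintype V] [Nonempty V] (F : Finset V → A) :
    CuttingEquation F ↔ ∑ M, F M = 0 := by
  have h : ∑ M, F M = F ∅ + F Finset.univ +
      ∑ M : Finset V with (M.Nonempty ∧ M ≠ Finset.univ), F M := by
    rw [← Finset.sum_filter_add_sum_filter_not Finset.univ
      (fun M : Finset V => M.Nonempty ∧ M ≠ Finset.univ), add_comm]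
    congr 1
    have : (Finset.univ.filter fun M : Finset V => ¬ (M.Nonempty ∧ M ≠ Finset.univ)) =
        {∅, Finset.univ} := by
      ext M
      simp only [Finset.mem_filter, Finset.mem_univ, true_and, not_and_or,
        Finset.not_nonempty_iff_eq_empty, not_not, Finset.mem_insert, Finset.mem_singleton]
    rw [this, Finset.sum_pair Finset.univ_nonempty.ne_empty.symm]
  rw [CuttingEquation, h, add_eq_zero_iff_eq_neg]

/-- The cutting equation for the energy integrals of a diagram without tadpoles. -/
theorem sum_vertexFactor_mul_integral_legFactor [Fintype V] [Nonempty V] (hG : G.TadpoleFree)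
    {ω : Leg → ℂ} (hω : ∀ i, (ω i).im < 0) (b : Module.Basis ι ℝ G.closedFlows) (q : Leg → ℝ) :
    ∑ M, G.vertexFactor M * ∫ e : ι → ℝ, G.legFactor ω (fun i => q i + flowCoord b i e) M = 0 := by
  have e : ∀ M, ∫ e : ι → ℝ, G.legFactor ω (fun i => q i + flowCoord b i e) M =
      ∑ s : Leg → ℤˣ, Complex.I ^ Fintype.card Leg * ∫ e : ι → ℝ,
        ∏ i, polarNumber (ω i) (decide (G.baseVertex s i ∈ M)) (s i) (q i + flowCoord b i e) := by
    intro M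
    simp only [legFactor_eq_sum]
    rw [integral_finsetSum _ fun s _ => (integrable_prod_polarNumber hG hω b q _ s).const_mul _]
    simp only [integral_const_mul]
  simp only [e, Finset.mul_sum]
  rw [Finset.sum_comm]
  refine Finset.sum_eq_zero fun s _ => ?_
  -- Either every vertex is a base, and each term vanishes by a polarized loop, or some vertex is
  -- not, and the terms cancel in pairs.
  by_cases h : ∀ v, ∃ i, G.baseVertex s i = v
  · obtain ⟨γ, hγ⟩ := exists_polarized_loop s h
    exact Finset.sum_eq_zero fun M _ => by
      rw [integral_prod_polarNumber_eq_zero hG hω b q _ s γ hγ, mul_zero, mul_zero]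
  · push Not at h
    obtain ⟨v, hv⟩ := h
    -- Toggling the mark of `v` permutes the markings, preserves the integrals and reverses the
    -- vertex factor, so the sum equals its own negative.
    refine self_eq_neg.1 ?_
    rw [← Finset.sum_neg_distrib]
    refine Fintype.sum_equiv (symmDiff_left_involutive ({v} : Finset V)).toPerm _ _ fun M => ?_
    simp only [Function.Involutive.coe_toPerm, vertexFactor_symmDiff, neg_mul, neg_neg]
    simp [Finset.mem_symmDiff, hv]

end FeynmanDiagram

namespace FeynmanDiagram

variable {V Leg X E W : Type*} {G : FeynmanDiagram V Leg X}

/-! ### Diagrams without tadpoles -/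

section Routing

variable [DecidableEq V] [Fintype Leg] [Fintype X]
    [NormedAddCommGroup E] [InnerProductSpace ℝ E] {L : ℕ} {p : X → ℝ × E}

theorem Routing.momentum_fst (ρ : G.Routing L p) (e : Fin L → ℝ) (k : Fin L → E) (i : Leg) :
    (ρ.momentum e k i).1 = (ρ.offset i).1 + flowCoord ρ.loops i e := by
  simp [Routing.momentum, flowCoord_apply, Prod.fst_sum]

/-- The space momentum of a leg. -/
noncomputable def Routing.spaceMomentum (ρ : G.Routing L p) (k : Fin L → E) (i : Leg) : E :=
  (ρ.offset i).2 + ∑ j, (ρ.loops j : Leg → ℝ) i • k j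

theorem Routing.momentum_snd (ρ : G.Routing L p) (e : Fin L → ℝ) (k : Fin L → E) (i : Leg) :
    (ρ.momentum e k i).2 = ρ.spaceMomentum k i := by
  simp [Routing.momentum, Routing.spaceMomentum, Prod.snd_sum]

variable [Fintype V]

theorem integrand_eq (ε : Leg → ℝ) (ρ : G.Routing L p) (M : Finset V) (e : Fin L → ℝ) (k : Fin L → E) :
    G.integrand ε ρ M e k = G.vertexFactor M *
      G.legFactor (fun i => frequency (ε i) (G.mass i) ‖ρ.spaceMomentum k i‖)
        (fun i => (ρ.offset i).1 + flowCoord ρ.loops i e) M := by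
  simp only [integrand, vertexFactor, legFactor, Routing.momentum_fst, Routing.momentum_snd]

variable [DecidableEq Leg]

theorem integrable_integrand {ε : Leg → ℝ} (hε : ∀ i, 0 < ε i) (ρ : G.Routing L p) (M : Finset V)
    (k : Fin L → E) : Integrable fun e : Fin L → ℝ => G.integrand ε ρ M e k := by
  simp only [integrand_eq]
  exact (integrable_legFactor (fun i => (frequency_re_im (hε i)).2) _ _ _).const_mul _

theorem sum_integral_integrand [Nonempty V] (hG : G.TadpoleFree) {ε : Leg → ℝ} (hε : ∀ i, 0 < ε i)
    (ρ : G.Routing L p) (k : Fin L → E) :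
    ∑ M, ∫ e : Fin L → ℝ, G.integrand ε ρ M e k = 0 := by
  simp only [integrand_eq, integral_const_mul]
  exact sum_vertexFactor_mul_integral_legFactor hG (fun i => (frequency_re_im (hε i)).2) _ _

theorem cuttingEquation_energyValue [Nonempty V] (hG : G.TadpoleFree) {ε : Leg → ℝ} (hε : ∀ i, 0 < ε i)
    (ρ : G.Routing L p) (k : Fin L → E) : CuttingEquation fun M => G.energyValue ε ρ M k := by
  rw [cuttingEquation_iff]
  simp only [energyValue]
  rw [← Finset.mul_sum, sum_integral_integrand hG hε, mul_zero]

/-- The cutting equation is preserved by linear maps on spaces of functions. -/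
theorem cuttingEquation_map [Nonempty V] [AddCommGroup W] [Module ℂ W] {Y : Type*} {A : Finset V → Y → ℂ}
    (h : ∀ k, CuttingEquation fun M => A M k) (dom : Submodule ℂ (Y → ℂ)) (R : dom →ₗ[ℂ] W)
    (hdom : ∀ M, A M ∈ dom) : CuttingEquation fun M => R ⟨A M, hdom M⟩ := by
  rw [cuttingEquation_iff, ← map_sum]
  convert map_zero R
  ext k
  have := (cuttingEquation_iff _).1 (h k)
  simpa using this

end Routing

/-! ### Integrals over energies and space momenta together -/

section Cutoff

variable [Fintype V] [DecidableEq V] [Fintype Leg] [DecidableEq Leg] [Fintype X] {d L : ℕ}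
    {p : X → ℝ × EuclideanSpace ℝ (Fin d)}

theorem volume_restrict_univ_prod (Λ : Set (Fin L → EuclideanSpace ℝ (Fin d))) :
    (volume : Measure ((Fin L → ℝ) × (Fin L → EuclideanSpace ℝ (Fin d)))).restrict (univ ×ˢ Λ) =
      (volume : Measure (Fin L → ℝ)).prod (volume.restrict Λ) := by
  rw [Measure.volume_eq_prod, ← Measure.prod_restrict, Measure.restrict_univ]

/-- The constants in the propagator bounds are continuous in the space momenta, hence bounded on the
compact closure of `Λ`. The majorant is a function of the energies alone, times a constant on a set
of finite measure. -/
theorem integrableOn_integrand (hG : G.TadpoleFree) {ε : Leg → ℝ} (hε : ∀ i, 0 < ε i)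
    (ρ : G.Routing L p) {Λ : Set (Fin L → EuclideanSpace ℝ (Fin d))} (hm : MeasurableSet Λ)
    (hΛ : Bornology.IsBounded Λ) (M : Finset V) :
    IntegrableOn (fun x : (Fin L → ℝ) × (Fin L → EuclideanSpace ℝ (Fin d)) =>
      G.integrand ε ρ M x.1 x.2) (univ ×ˢ Λ) := by
  set ω : (Fin L → EuclideanSpace ℝ (Fin d)) → Leg → ℂ :=
    fun k i => frequency (ε i) (G.mass i) ‖ρ.spaceMomentum k i‖ with hω
  have him : ∀ k i, (ω k i).im < 0 := fun k i => (frequency_re_im (hε i)).2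
  have hωc : ∀ i, Continuous fun k => ω k i := fun i => by
    refine (continuous_frequency (hε i)).comp ?_
    unfold Routing.spaceMomentum
    fun_prop
  have hC : ∀ i, ∃ C, ∀ k ∈ Λ, 1 / ‖ω k i‖ * decayConst (ω k i) ≤ C := by
    intro i
    have hcont : Continuous fun k => 1 / ‖ω k i‖ * decayConst (ω k i) := by
      have h0 : ∀ k, ‖ω k i‖ ≠ 0 := fun k => by
        rw [norm_ne_zero_iff]; intro h; simpa [h] using him k i
      have h1 : ∀ k, |(ω k i).im| ≠ 0 := fun k => abs_ne_zero.2 (him k i).ne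
      have h2 := hωc i
      unfold decayConst
      exact (continuous_const.div h2.norm h0).mul (continuous_const.add
        ((continuous_const.add h2.norm).div (Complex.continuous_im.comp h2).abs h1))
    obtain ⟨C, hC⟩ := hΛ.isCompact_closure.exists_bound_of_continuousOn hcont.continuousOn
    exact ⟨C, fun k hk => (le_abs_self _).trans (hC k (subset_closure hk))⟩
  choose C hC using hC
  have hfin : volume Λ < ⊤ := hΛ.measure_lt_top
  have : IsFiniteMeasure (volume.restrict Λ) := ⟨by simpa using hfin⟩
  have hdecay := integrable_prod_inv_one_add_abs (flowCoord ρ.loops) (fun i => (ρ.offset i).1)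
    (eq_zero_of_flowCoord ρ.loops) fun i e => eq_zero_of_flowCoord_ne ρ.loops (hG i) e
  have hdom := (hdecay.const_mul (‖G.vertexFactor M‖ * ∏ i, C i)).mul_prod
    (integrable_const (μ := volume.restrict Λ) (1 : ℝ))
  rw [← volume_restrict_univ_prod] at hdom
  refine Integrable.mono' hdom ?_ ?_
  · simp only [integrand_eq]
    refine Continuous.aestronglyMeasurable (continuous_const.mul (continuous_finsetProd _ fun i _ =>
      continuous_const.mul (continuous_propagator ((hωc i).comp continuous_snd)
        (continuous_const.add ((continuous_flowCoord _ i).comp continuous_fst))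
        (fun x => (him x.2 i).ne) _ _)))
  · refine (ae_restrict_iff' (MeasurableSet.univ.prod hm)).2 (ae_of_all _ fun x hx => ?_)
    rw [integrand_eq, norm_mul, mul_one, mul_assoc, ← Finset.prod_mul_distrib, legFactor, norm_prod]
    refine mul_le_mul_of_nonneg_left (Finset.prod_le_prod (fun _ _ => norm_nonneg _) fun i _ => ?_)
      (norm_nonneg _)
    rw [norm_mul, Complex.norm_I, one_mul]
    exact (norm_propagator_le (him x.2 i).ne _ _ _).trans
      (mul_le_mul_of_nonneg_right (hC i x.2 hx.2) (by positivity))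

/-- Absolute convergence permits summing over markings and integrating the energies first; the inner
integral is already zero at each point of space momenta. -/
theorem cuttingEquation_loopValue [Nonempty V] (hG : G.TadpoleFree) {ε : Leg → ℝ} (hε : ∀ i, 0 < ε i)
    (ρ : G.Routing L p) (Λ : Set (Fin L → EuclideanSpace ℝ (Fin d)))
    (h : ∀ M, IntegrableOn (fun x : (Fin L → ℝ) × (Fin L → EuclideanSpace ℝ (Fin d)) =>
      G.integrand ε ρ M x.1 x.2) (univ ×ˢ Λ)) : CuttingEquation (G.loopValue ε ρ Λ) := by
  rw [cuttingEquation_iff]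
  simp only [loopValue]
  rw [← Finset.mul_sum, ← integral_finsetSum _ fun M _ => h M]
  have hs := integrable_finsetSum Finset.univ fun M _ => h M
  rw [volume_restrict_univ_prod] at hs ⊢
  rw [integral_prod_symm _ hs]
  have : ∀ k, ∫ e : Fin L → ℝ, ∑ M, G.integrand ε ρ M e k = 0 := fun k => by
    rw [integral_finsetSum _ fun M _ => integrable_integrand hε ρ M k, sum_integral_integrand hG hε]
  simp [this]

end Cutoff

/-! ### Diagrams with tadpoles -/

theorem dropTadpoles_tadpoleFree : G.dropTadpoles.TadpoleFree := fun i => i.2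

/-- A nonzero coupling can be divided out of the tadpole assumption, leaving equal marked and
unmarked products at each vertex. The tadpoles are then a common factor of all markings. -/
theorem tadpoleFactor_eq [DecidableEq V] [Fintype V] [Fintype Leg] (hc : ∀ v, G.coupling v ≠ 0) {t : Leg → Bool → ℂ}
    (ht : G.TadpoleAssumption t) (M : Finset V) : G.tadpoleFactor t M = G.tadpoleFactor t ∅ := by
  have hv : ∀ v, ∏ i with (G.IsTadpole i ∧ G.src i = v), t i true =
      ∏ i with (G.IsTadpole i ∧ G.src i = v), t i false := by
    intro v
    by_cases h : ∃ i, G.IsTadpole i ∧ G.src i = v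
    · have h1 := ht v h
      have h2 : Complex.I * (G.coupling v : ℂ) ≠ 0 :=
        mul_ne_zero Complex.I_ne_zero (by exact_mod_cast hc v)
      rw [neg_mul, neg_inj] at h1
      exact (mul_left_cancel₀ h2 h1).symm
    · have : (Finset.univ.filter fun i => G.IsTadpole i ∧ G.src i = v) = ∅ :=
        Finset.filter_eq_empty_iff.2 fun i _ hi => h ⟨i, hi⟩
      rw [this, Finset.prod_empty, Finset.prod_empty]
  have key : ∀ M, G.tadpoleFactor t M = ∏ v, ∏ i with (G.IsTadpole i ∧ G.src i = v), t i (decide (v ∈ M)) := by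
    intro M
    rw [tadpoleFactor, ← Finset.prod_fiberwise _ G.src]
    refine Finset.prod_congr rfl fun v _ => ?_
    rw [Finset.filter_filter]
    refine Finset.prod_congr rfl fun i hi => ?_
    rw [(Finset.mem_filter.1 hi).2.2]
  rw [key, key]
  refine Finset.prod_congr rfl fun v _ => ?_
  by_cases h : v ∈ M
  · simpa [h] using hv v
  · simp [h]

theorem cuttingEquation_tadpoleFactor_smul [Fintype V] [DecidableEq V] [Nonempty V] [Fintype Leg]
    [DecidableEq Leg] [Fintype X] [NormedAddCommGroup E] [InnerProductSpace ℝ E] [AddCommGroup W]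
    [Module ℂ W] {ε : Leg → ℝ} (hε : ∀ i, 0 < ε i) {t : Leg → Bool → ℂ} (ht : G.TadpoleAssumption t)
    (L : ℕ) (p : X → ℝ × E) (ρ : G.dropTadpoles.Routing L p)
    (dom : Submodule ℂ ((Fin L → E) → ℂ)) (R : dom →ₗ[ℂ] W)
    (hdom : ∀ M, G.dropTadpoles.energyValue (fun i => ε i) ρ M ∈ dom) :
    CuttingEquation (fun M => G.tadpoleFactor t M •
      R ⟨G.dropTadpoles.energyValue (fun i => ε i) ρ M, hdom M⟩) := by
  have he : ∀ k, CuttingEquation fun M =>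
      G.dropTadpoles.energyValue (fun i : {i // ¬ G.IsTadpole i} => ε i) ρ M k := fun k =>
    cuttingEquation_energyValue dropTadpoles_tadpoleFree (ε := fun i : {i // ¬ G.IsTadpole i} => ε i)
      (fun i => hε i) ρ k
  have h0 := cuttingEquation_map (A := fun M k => G.dropTadpoles.energyValue
    (fun i : {i // ¬ G.IsTadpole i} => ε i) ρ M k) he dom R hdom
  rw [cuttingEquation_iff] at h0 ⊢
  by_cases hc : ∀ v, G.coupling v ≠ 0
  · simp only [tadpoleFactor_eq hc ht]
    rw [← Finset.smul_sum, h0, smul_zero]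
  -- At a vertex of zero coupling the assumption says nothing about the tadpoles, but then every
  -- marked diagram vanishes.
  · push Not at hc
    obtain ⟨v, hv⟩ := hc
    refine Finset.sum_eq_zero fun M _ => ?_
    have : (⟨G.dropTadpoles.energyValue (fun i => ε i) ρ M, hdom M⟩ : dom) = 0 := by
      ext k
      have hvf : G.dropTadpoles.vertexFactor M = 0 := Finset.prod_eq_zero (Finset.mem_univ v) (by
        simp [dropTadpoles, hv])
      simp [energyValue, integrand_eq, hvf]
    rw [this, map_zero, smul_zero]

/-! ### The energy integrals of the tadpoles -/

section Tadpoles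

variable [DecidableEq V] [Fintype Leg]

/-- A tadpole enters and leaves the same vertex, so it drops out of the conservation law. -/
theorem mem_closedFlows_iff (f : Leg → ℝ) :
    f ∈ G.closedFlows ↔ (fun i : {i // ¬ G.IsTadpole i} => f i) ∈ G.dropTadpoles.closedFlows := by
  refine forall_congr' fun v => ?_
  have key : ∀ g : Leg → V, ∑ i with g i = v, f i =
      (∑ i : {i // G.IsTadpole i}, if g i = v then f i else 0) +
        ∑ i : {i // ¬ G.IsTadpole i}, if g i = v then f i else 0 := by
    intro g
    rw [Finset.sum_filter, ← Fintype.sum_subtype_add_sum_subtype G.IsTadpole]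
  have ht : (∑ i : {i // G.IsTadpole i}, if G.tgt i = v then f i else 0) =
      ∑ i : {i // G.IsTadpole i}, if G.src i = v then f i else 0 :=
    Finset.sum_congr rfl fun i _ => by rw [show G.src i = G.tgt i from i.2]
  rw [key, key, ht, add_right_inj, Finset.sum_filter, Finset.sum_filter]
  rfl

/-- A closed flow is a closed flow through the legs that are no tadpoles, together with arbitrary
flows through the tadpoles. -/
noncomputable def closedFlowsEquiv (G : FeynmanDiagram V Leg X) :
    (G.dropTadpoles.closedFlows × ({i // G.IsTadpole i} → ℝ)) ≃ₗ[ℝ] G.closedFlows where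
  toFun x := ⟨fun i => if h : G.IsTadpole i then x.2 ⟨i, h⟩ else (x.1 : {i // ¬ G.IsTadpole i} → ℝ) ⟨i, h⟩, by
    rw [mem_closedFlows_iff]
    convert x.1.2 using 1
    funext i
    simp [i.2]⟩
  map_add' x y := by
    ext i
    by_cases h : G.IsTadpole i <;> simp [h]
  map_smul' c x := by
    ext i
    by_cases h : G.IsTadpole i <;> simp [h]
  invFun f := (⟨fun i => (f : Leg → ℝ) i, (mem_closedFlows_iff _).1 f.2⟩, fun i => (f : Leg → ℝ) i)
  left_inv x := by
    ext i
    · simp [i.2]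
    · simp [i.2]
  right_inv f := by
    ext i
    by_cases h : G.IsTadpole i <;> simp [h]

/-- Closed flows split into those of the reduced diagram and free tadpole flows, and the integrand
splits accordingly. The Jacobian `c` depends on the two bases only, not on widths, momenta or
marking; translation invariance removes the offsets of the tadpole energies. -/
theorem exists_integral_legFactor_eq {ι κ : Type*} [Fintype ι] [Fintype κ]
    (b : Module.Basis ι ℝ G.closedFlows) (b' : Module.Basis κ ℝ G.dropTadpoles.closedFlows) :
    ∃ c : ℂ, ∀ (ω : Leg → ℂ) (q : Leg → ℝ) (M : Finset V), (∀ i, 0 < (ω i).re) → (∀ i, (ω i).im < 0) →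
      ∫ e : ι → ℝ, G.legFactor ω (fun i => q i + flowCoord b i e) M =
        c * ((∫ e : κ → ℝ, G.dropTadpoles.legFactor (fun i => ω i)
            (fun i => q i + flowCoord b' i e) M) *
          ∏ i : {i // G.IsTadpole i}, Real.pi / (if G.src i ∈ M then conj (ω i) else ω i)) := by
  let T : ((κ → ℝ) × ({i // G.IsTadpole i} → ℝ)) ≃L[ℝ] (ι → ℝ) :=
    ((b'.equivFun.symm.prodCongr (LinearEquiv.refl ℝ _)) ≪≫ₗ G.closedFlowsEquiv ≪≫ₗ
      b.equivFun).toContinuousLinearEquiv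
  have hT : ∀ x i, flowCoord b i (T x) =
      if h : G.IsTadpole i then x.2 ⟨i, h⟩ else flowCoord b' ⟨i, h⟩ x.1 := fun x i =>
    flowCoord_equivFun b i (G.closedFlowsEquiv (b'.equivFun.symm x.1, x.2))
  have := isAddHaarMeasure_volume_prod (κ → ℝ) ({i // G.IsTadpole i} → ℝ)
  obtain ⟨c, hc⟩ := T.exists_integral_eq_mul
  refine ⟨c, fun ω q M hre him => ?_⟩
  rw [hc]
  congr 1
  have hsplit : ∀ x : (κ → ℝ) × ({i // G.IsTadpole i} → ℝ),
      G.legFactor ω (fun i => q i + flowCoord b i (T x)) M =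
      (G.dropTadpoles.legFactor (fun i => ω i) (fun i => q i + flowCoord b' i x.1) M) *
        ∏ i : {i // G.IsTadpole i}, Complex.I * propagator (ω i) (decide (G.src i ∈ M))
          (decide (G.src i ∈ M)) (q i + x.2 i) := by
    intro x
    rw [legFactor, ← Fintype.prod_subtype_mul_prod_subtype G.IsTadpole, mul_comm]
    congr 1
    · refine Finset.prod_congr rfl fun i _ => ?_
      rw [hT, dif_neg i.2]
      rfl
    · refine Finset.prod_congr rfl fun i _ => ?_
      rw [hT, dif_pos i.2, show G.tgt i = G.src i from i.2.symm]
  simp only [hsplit]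
  rw [Measure.volume_eq_prod, integral_prod_mul (fun e : κ → ℝ => G.dropTadpoles.legFactor (fun i => ω i)
    (fun i => q i + flowCoord b' i e) M) (fun x : {i // G.IsTadpole i} → ℝ =>
      ∏ i : {i // G.IsTadpole i}, Complex.I * propagator (ω i) (decide (G.src i ∈ M))
          (decide (G.src i ∈ M)) (q i + x i))]
  congr 1
  rw [integral_fintype_prod_volume_eq_prod (fun (i : {i // G.IsTadpole i}) (x : ℝ) =>
    Complex.I * propagator (ω i) (decide (G.src i ∈ M)) (decide (G.src i ∈ M)) (q i + x))]
  refine Finset.prod_congr rfl fun i _ => ?_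
  rw [integral_add_left_eq_self (fun x : ℝ => Complex.I * propagator (ω i) (decide (G.src i ∈ M))
    (decide (G.src i ∈ M)) x) (q i), integral_propagator_self (hre i) (him i)]
  simp

theorem tendsto_frequency_zero {m : ℝ} (hm : m ≠ 0) (r : ℝ) :
    Tendsto (fun η => frequency η m r) (𝓝 0) (𝓝 (frequency 0 m r)) := by
  unfold frequency
  refine Tendsto.cpow (Continuous.tendsto (by fun_prop) _) tendsto_const_nhds ?_
  exact frequency_sq_mem_slitPlane (Or.inr hm)

theorem frequency_zero_ne_zero {m : ℝ} (hm : m ≠ 0) (r : ℝ) : frequency 0 m r ≠ 0 := by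
  rw [frequency, Ne, Complex.cpow_eq_zero_iff, not_and_or]
  exact Or.inl (Complex.slitPlane_ne_zero (frequency_sq_mem_slitPlane (Or.inr hm)))

theorem conj_frequency {η m : ℝ} (h : 0 < η ∨ m ≠ 0) (r : ℝ) :
    conj (frequency η m r) = frequency (-η) m r := by
  have hs := frequency_sq_mem_slitPlane (r := r) h
  have h1 := Complex.conj_cpow _ (1 / 2) (Complex.slitPlane_arg_ne_pi hs)
  rw [show conj (1 / 2 : ℂ) = 1 / 2 by simp [Complex.conj_ofNat]] at h1
  rw [frequency, frequency, ← h1]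
  simp

/-- By the factorization the tadpole widths appear only in the factors π/ω, whose limits are
independent of the marking. The sum over markings is thus a common factor times that of the reduced
diagram. -/
theorem exists_tendsto_energyValue [Fintype V] [Nonempty V] [DecidableEq Leg] [Fintype X]
    [NormedAddCommGroup E] [InnerProductSpace ℝ E] {ε : Leg → ℝ} (hε : ∀ i, 0 < ε i)
    (hm : ∀ i, G.IsTadpole i → 0 < G.mass i) {L : ℕ} {p : X → ℝ × E} (ρ : G.Routing L p) :
    ∃ A : Finset V → (Fin L → E) → ℂ,
      (∀ M k, Tendsto (fun η : Leg → ℝ => G.energyValue (G.withTadpoleWidths ε η) ρ M k)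
        (𝓝[{η | ∀ i, 0 < η i}] 0) (𝓝 (A M k))) ∧
      ∀ k, CuttingEquation (fun M => A M k) := by
  obtain ⟨c, hc⟩ := exists_integral_legFactor_eq ρ.loops (Module.finBasis ℝ G.dropTadpoles.closedFlows)
  let r : (Fin L → E) → Leg → ℝ := fun k i => ‖ρ.spaceMomentum k i‖
  let J : Finset V → (Fin L → E) → ℂ := fun M k => ∫ e, G.dropTadpoles.legFactor
    (fun i => frequency (ε i) (G.mass i) (r k i))
    (fun i => (ρ.offset i).1 + flowCoord (Module.finBasis ℝ G.dropTadpoles.closedFlows) i e) M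
  refine ⟨fun M k => ((2 * Real.pi : ℂ)⁻¹) ^ L * (G.vertexFactor M * (c * (J M k *
    ∏ i : {i // G.IsTadpole i}, Real.pi / frequency 0 (G.mass i) (r k i)))), fun M k => ?_, fun k => ?_⟩
  · have hev : ∀ η ∈ {η : Leg → ℝ | ∀ i, 0 < η i},
        ((2 * Real.pi : ℂ)⁻¹) ^ L * (G.vertexFactor M * (c * (J M k *
          ∏ i : {i // G.IsTadpole i}, Real.pi / (if G.src i ∈ M then
            conj (frequency (η i) (G.mass i) (r k i)) else frequency (η i) (G.mass i) (r k i))))) =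
        G.energyValue (G.withTadpoleWidths ε η) ρ M k := by
      intro η hη
      have hpos : ∀ i, 0 < G.withTadpoleWidths ε η i := fun i => by
        unfold withTadpoleWidths
        split_ifs
        · exact hη i
        · exact hε i
      simp only [energyValue, integrand_eq, integral_const_mul]
      rw [hc _ _ _ (fun i => (frequency_re_im (hpos i)).1) (fun i => (frequency_re_im (hpos i)).2)]
      have h1 : ∀ i : {i // G.IsTadpole i}, G.withTadpoleWidths ε η i = η i := fun i => if_pos i.2
      have h2 : ∀ i : {i // ¬ G.IsTadpole i}, G.withTadpoleWidths ε η i = ε i := fun i => if_neg i.2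
      simp only [h1, h2]
      rfl
    refine Tendsto.congr' (eventually_nhdsWithin_of_forall hev) ?_
    refine Tendsto.const_mul _ (Tendsto.const_mul _ (Tendsto.const_mul _ (Tendsto.const_mul _
      (tendsto_finsetProd _ fun i _ => Tendsto.div tendsto_const_nhds ?_
        (frequency_zero_ne_zero (hm i i.2).ne' _)))))
    have hi : Tendsto (fun η : Leg → ℝ => η i) (𝓝[{η | ∀ i, 0 < η i}] 0) (𝓝 0) :=
      ((continuous_apply (i : Leg)).tendsto (0 : Leg → ℝ)).mono_left nhdsWithin_le_nhds
    have hf := (tendsto_frequency_zero (hm i i.2).ne' (r k i)).comp hi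
    split_ifs
    -- Conjugation reverses the sign of the width, hence fixes the frequency of width zero: marked
    -- and unmarked limits agree.
    · have := (Complex.continuous_conj.tendsto _).comp hf
      rwa [conj_frequency (Or.inr (hm i i.2).ne'), neg_zero] at this
    · exact hf
  · rw [cuttingEquation_iff]
    have h0 := sum_vertexFactor_mul_integral_legFactor (dropTadpoles_tadpoleFree (G := G))
      (ω := fun i => frequency (ε i) (G.mass i) (r k i)) (fun i => (frequency_re_im (hε i)).2)
      (Module.finBasis ℝ G.dropTadpoles.closedFlows) (fun i => (ρ.offset i).1)
    rw [← Finset.mul_sum]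
    have h2 : ∀ M, G.vertexFactor M * (c * (J M k *
        ∏ i : {i // G.IsTadpole i}, (Real.pi : ℂ) / frequency 0 (G.mass i) (r k i))) =
        (c * ∏ i : {i // G.IsTadpole i}, (Real.pi : ℂ) / frequency 0 (G.mass i) (r k i)) *
          (G.vertexFactor M * J M k) := fun M => by ring
    rw [Finset.sum_congr rfl fun M _ => h2 M, ← Finset.mul_sum,
      show ∑ M, G.vertexFactor M * J M k = 0 from h0, mul_zero, mul_zero]

end Tadpoles

end FeynmanDiagram

/-! ### Dimensional regularization of the tadpole -/

theorem ofReal_rpow_two_cpow {x : ℝ} (hx : 0 < x) (w : ℂ) :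
    ((x ^ (2 : ℝ) : ℝ) : ℂ) ^ w = (x : ℂ) ^ (2 * w) := by
  have h1 : ((x ^ (2 : ℝ) : ℝ) : ℂ) ≠ 0 := by exact_mod_cast (Real.rpow_pos_of_pos hx 2).ne'
  have h2 : (x : ℂ) ≠ 0 := by exact_mod_cast hx.ne'
  rw [Complex.cpow_def_of_ne_zero h1, Complex.cpow_def_of_ne_zero h2,
    ← Complex.ofReal_log (Real.rpow_pos_of_pos hx 2).le, ← Complex.ofReal_log hx.le, Real.log_rpow hx]
  push_cast
  ring_nf

theorem integrableOn_cpow_mul_exp_neg_mul {a z : ℂ} (ha : 0 < a.re) (hz : 0 < z.re) :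
    IntegrableOn (fun t : ℝ => (t : ℂ) ^ (a - 1) * Complex.exp (-(z * t))) (Ioi 0) := by
  have h1 : IntegrableOn (fun t : ℝ => t ^ (a.re - 1) * Real.exp (-z.re * t ^ (1 : ℝ))) (Ioi 0) :=
    integrableOn_rpow_mul_exp_neg_mul_rpow (by linarith) one_pos hz
  refine Integrable.mono' h1 ?_ ?_
  · refine ContinuousOn.aestronglyMeasurable (fun t ht => ?_) measurableSet_Ioi
    exact ((ContinuousAt.cpow (by fun_prop) continuousAt_const
      (Complex.ofReal_mem_slitPlane.2 ht)).mul (by fun_prop)).continuousWithinAt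
  · refine (ae_restrict_iff' measurableSet_Ioi).2 (ae_of_all _ fun t ht => ?_)
    rw [norm_mul, Complex.norm_cpow_eq_rpow_re_of_pos ht, Complex.norm_exp]
    simp

/-- Euler's integral with a complex scale. -/
theorem integral_cpow_mul_exp_neg_mul_of_re_pos {a c : ℂ} (ha : 0 < a.re) (hc : 0 < c.re) :
    ∫ t in Ioi (0 : ℝ), (t : ℂ) ^ (a - 1) * Complex.exp (-(c * t)) = (1 / c) ^ a * Complex.Gamma a := by
  have hopen : IsOpen {z : ℂ | 0 < z.re} := isOpen_lt continuous_const Complex.continuous_re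
  have hf : DifferentiableOn ℂ (fun z : ℂ => ∫ t in Ioi (0 : ℝ), (t : ℂ) ^ (a - 1) *
      Complex.exp (-(z * t))) {z | 0 < z.re} := by
    intro z hz
    have hz' : 0 < z.re := hz
    have hnear : ∀ w ∈ Metric.ball z (z.re / 2), z.re / 2 ≤ w.re := by
      intro w hw
      have h1 := (Complex.abs_re_le_norm (w - z)).trans (mem_ball_iff_norm.1 hw).le
      rw [Complex.sub_re, abs_le] at h1
      linarith [h1.1]
    have hcont : ∀ w : ℂ, ContinuousOn (fun t : ℝ => (t : ℂ) ^ (a - 1) * Complex.exp (-(w * t))) (Ioi 0) :=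
      fun w t ht => ((ContinuousAt.cpow (by fun_prop) continuousAt_const
        (Complex.ofReal_mem_slitPlane.2 ht)).mul (by fun_prop)).continuousWithinAt
    have hbound : IntegrableOn (fun t : ℝ => t ^ a.re * Real.exp (-(z.re / 2) * t ^ (1 : ℝ))) (Ioi 0) :=
      integrableOn_rpow_mul_exp_neg_mul_rpow (by linarith) one_pos (by linarith)
    have := hasDerivAt_integral_of_dominated_loc_of_deriv_le (μ := volume.restrict (Ioi (0 : ℝ)))
      (F := fun (z : ℂ) (t : ℝ) => (t : ℂ) ^ (a - 1) * Complex.exp (-(z * t)))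
      (F' := fun (z : ℂ) (t : ℝ) => (t : ℂ) ^ (a - 1) * Complex.exp (-(z * t)) * (-(t : ℂ)))
      (x₀ := z) (s := Metric.ball z (z.re / 2))
      (bound := fun t : ℝ => t ^ a.re * Real.exp (-(z.re / 2) * t ^ (1 : ℝ)))
      (Metric.ball_mem_nhds z (by linarith))
      (Eventually.of_forall fun w => (hcont w).aestronglyMeasurable measurableSet_Ioi)
      (integrableOn_cpow_mul_exp_neg_mul ha hz')
      (((hcont z).mul (by fun_prop)).aestronglyMeasurable measurableSet_Ioi)
      ((ae_restrict_iff' measurableSet_Ioi).2 (ae_of_all _ fun t ht w hw => by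
        have ht0 : 0 < t := ht
        rw [norm_mul, norm_mul, Complex.norm_cpow_eq_rpow_re_of_pos ht, Complex.norm_exp, norm_neg,
          Complex.norm_of_nonneg ht0.le, mul_right_comm]
        have e : t ^ (a - 1).re * t = t ^ a.re := by
          rw [← Real.rpow_add_one ht0.ne']
          simp
        rw [e, Real.rpow_one]
        refine mul_le_mul_of_nonneg_left (Real.exp_le_exp.2 ?_) (Real.rpow_nonneg ht0.le _)
        have : (-(w * (t : ℂ))).re = -w.re * t := by simp
        rw [this]
        nlinarith [hnear w hw]))
      hbound
      (ae_of_all _ fun t w _ => by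
        have h1 : HasDerivAt (fun w : ℂ => -(w * t)) (-(t : ℂ)) w := by
          have h0 := (hasDerivAt_id w).mul_const (t : ℂ)
          rw [one_mul] at h0
          exact h0.neg
        have h2 := (h1.cexp).const_mul ((t : ℂ) ^ (a - 1))
        simpa only [mul_assoc] using h2)
    exact this.2.differentiableAt.differentiableWithinAt
  have hg : DifferentiableOn ℂ (fun z : ℂ => (1 / z) ^ a * Complex.Gamma a) {z | 0 < z.re} := by
    intro z hz
    have hz' : 0 < z.re := hz
    have hz0 : z ≠ 0 := by rintro rfl; simp at hz'
    refine DifferentiableAt.differentiableWithinAt (DifferentiableAt.mul_const ?_ _)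
    refine DifferentiableAt.cpow (by fun_prop (disch := exact hz0)) (by fun_prop) ?_
    rw [one_div, Complex.mem_slitPlane_iff, Complex.inv_re]
    exact Or.inl (div_pos hz' (Complex.normSq_pos.2 hz0))
  -- Both sides are holomorphic in the scale on the right half plane and agree for positive real
  -- scales, which accumulate at 1; the identity theorem does the rest.
  have hpre : IsPreconnected {z : ℂ | 0 < z.re} := (convex_halfSpace_re_gt 0).isPreconnected
  refine (hf.analyticOnNhd hopen).eqOn_of_preconnected_of_frequently_eq (hg.analyticOnNhd hopen) hpre
    (z₀ := 1) (by simp) ?_ hc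
  have hreal : ∀ x : ℝ, 0 < x → ∫ t in Ioi (0 : ℝ), (t : ℂ) ^ (a - 1) * Complex.exp (-((x : ℂ) * t)) =
      (1 / (x : ℂ)) ^ a * Complex.Gamma a := fun x hx =>
    Complex.integral_cpow_mul_exp_neg_mul_Ioi ha hx
  have hseq : Tendsto (fun x : ℝ => (x : ℂ)) (𝓝[≠] 1) (𝓝[≠] 1) := by
    refine tendsto_nhdsWithin_iff.2 ⟨?_, ?_⟩
    · exact (Complex.continuous_ofReal.tendsto 1).mono_left nhdsWithin_le_nhds
    · filter_upwards [self_mem_nhdsWithin] with x hx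
      simpa using hx
  refine hseq.frequently (Eventually.frequently ?_)
  filter_upwards [nhdsWithin_le_nhds (lt_mem_nhds (zero_lt_one' ℝ))] with x hx using hreal x hx

/-- The substitution y = r² reduces this to Euler's integral. -/
theorem integral_cpow_mul_exp_neg_mul_sq {s : ℂ} (hs : 0 < s.re) {t : ℝ} (ht : 0 < t) :
    ∫ r in Ioi (0 : ℝ), (r : ℂ) ^ (s - 1) * Complex.exp (-(t * (r : ℂ) ^ 2)) =
      1 / 2 * (t : ℂ) ^ (-(s / 2)) * Complex.Gamma (s / 2) := by
  have h1 := integral_comp_rpow_Ioi_of_pos (g := fun y : ℝ =>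
    (y : ℂ) ^ (s / 2 - 1) * Complex.exp (-(t * y))) (p := 2) (by norm_num)
  have h2 := Complex.integral_cpow_mul_exp_neg_mul_Ioi (a := s / 2) (r := t)
    (by rw [show s / 2 = s * ((1 / 2 : ℝ) : ℂ) by push_cast; ring, Complex.re_mul_ofReal]; positivity)
    (by simpa using ht)
  rw [h2] at h1
  have h3 : ∀ r ∈ Ioi (0 : ℝ), ((2 : ℝ) * r ^ ((2 : ℝ) - 1)) • (((r ^ (2 : ℝ) : ℝ) : ℂ) ^ (s / 2 - 1) *
      Complex.exp (-(t * ((r ^ (2 : ℝ) : ℝ) : ℂ)))) =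
      2 * ((r : ℂ) ^ (s - 1) * Complex.exp (-(t * (r : ℂ) ^ 2))) := by
    intro r hr
    have hr0 : (r : ℂ) ≠ 0 := by exact_mod_cast (mem_Ioi.1 hr).ne'
    rw [ofReal_rpow_two_cpow hr, Complex.real_smul, show (2 : ℝ) - 1 = 1 by norm_num, Real.rpow_one,
      Real.rpow_two, show s - 1 = 2 * (s / 2 - 1) + 1 by ring, Complex.cpow_add _ _ hr0, Complex.cpow_one]
    push_cast
    ring
  rw [setIntegral_congr_fun measurableSet_Ioi h3, integral_const_mul] at h1
  have ht' : (1 / (t : ℂ)) ^ (s / 2) = (t : ℂ) ^ (-(s / 2)) := by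
    rw [one_div, Complex.inv_cpow, Complex.cpow_neg]
    rw [Complex.arg_ofReal_of_nonneg ht.le]
    exact Real.pi_pos.ne
  rw [ht'] at h1
  linear_combination (1 / 2) * h1

/-- The function of two variables to which Fubini's theorem is applied. -/
theorem integrable_cpow_mul_exp_prod {s c : ℂ} (hs0 : 0 < s.re) (hs1 : s.re < 1) (hc : 0 < c.re) :
    Integrable (Function.uncurry fun r t : ℝ => (r : ℂ) ^ (s - 1) * Complex.exp (-(t * (r : ℂ) ^ 2)) *
      ((t : ℂ) ^ (1 / 2 - 1 : ℂ) * Complex.exp (-(c * t))))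
      ((volume.restrict (Ioi (0 : ℝ))).prod (volume.restrict (Ioi (0 : ℝ)))) := by
  have hmeas : AEStronglyMeasurable (Function.uncurry fun r t : ℝ =>
      (r : ℂ) ^ (s - 1) * Complex.exp (-(t * (r : ℂ) ^ 2)) *
      ((t : ℂ) ^ (1 / 2 - 1 : ℂ) * Complex.exp (-(c * t))))
      ((volume.restrict (Ioi (0 : ℝ))).prod (volume.restrict (Ioi (0 : ℝ)))) := by
    rw [Measure.prod_restrict]
    refine ContinuousOn.aestronglyMeasurable ?_ (measurableSet_Ioi.prod measurableSet_Ioi)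
    intro x hx
    have h1 : (x.1 : ℂ) ∈ Complex.slitPlane := Complex.ofReal_mem_slitPlane.2 hx.1
    have h2 : (x.2 : ℂ) ∈ Complex.slitPlane := Complex.ofReal_mem_slitPlane.2 hx.2
    refine ContinuousAt.continuousWithinAt ?_
    simp only [Function.uncurry_def]
    refine ContinuousAt.mul (ContinuousAt.mul ?_ (by fun_prop)) (ContinuousAt.mul ?_ (by fun_prop))
    · exact ContinuousAt.cpow (by fun_prop) continuousAt_const h1
    · exact ContinuousAt.cpow (by fun_prop) continuousAt_const h2
  have hnorm : ∀ t ∈ Ioi (0 : ℝ), ∀ r ∈ Ioi (0 : ℝ),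
      ‖(r : ℂ) ^ (s - 1) * Complex.exp (-(t * (r : ℂ) ^ 2)) *
        ((t : ℂ) ^ (1 / 2 - 1 : ℂ) * Complex.exp (-(c * t)))‖ =
      r ^ (s.re - 1) * Real.exp (-t * r ^ (2 : ℝ)) * (t ^ (-(1 / 2) : ℝ) * Real.exp (-c.re * t)) := by
    intro t ht r hr
    rw [norm_mul, norm_mul, norm_mul, Complex.norm_cpow_eq_rpow_re_of_pos hr,
      Complex.norm_cpow_eq_rpow_re_of_pos ht, Complex.norm_exp, Complex.norm_exp, Real.rpow_two]
    have h1 : (s - 1).re = s.re - 1 := by simp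
    have h2 : (1 / 2 - 1 : ℂ).re = -(1 / 2) := by norm_num
    have h3 : (-((t : ℂ) * (r : ℂ) ^ 2)).re = -t * r ^ 2 := by
      rw [← Complex.ofReal_pow, ← Complex.ofReal_mul, Complex.neg_re, Complex.ofReal_re, neg_mul]
    have h4 : (-(c * (t : ℂ))).re = -c.re * t := by simp
    rw [h1, h2, h3, h4]
  have hint : ∀ t ∈ Ioi (0 : ℝ), IntegrableOn (fun r : ℝ =>
      r ^ (s.re - 1) * Real.exp (-t * r ^ (2 : ℝ))) (Ioi 0) := fun t ht =>
    integrableOn_rpow_mul_exp_neg_mul_rpow (by linarith) (by norm_num) ht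
  rw [integrable_prod_iff' hmeas]
  refine ⟨?_, ?_⟩
  · refine (ae_restrict_iff' measurableSet_Ioi).2 (ae_of_all _ fun t ht => ?_)
    refine Integrable.mono' ((hint t ht).mul_const (t ^ (-(1 / 2) : ℝ) * Real.exp (-c.re * t))) ?_ ?_
    · refine ContinuousOn.aestronglyMeasurable (fun r hr => ?_) measurableSet_Ioi
      have h1 : (r : ℂ) ∈ Complex.slitPlane := Complex.ofReal_mem_slitPlane.2 hr
      refine ContinuousAt.continuousWithinAt ?_
      simp only [Function.uncurry_def]
      exact ((ContinuousAt.cpow (by fun_prop) continuousAt_const h1).mul (by fun_prop)).mul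
        continuousAt_const
    · exact (ae_restrict_iff' measurableSet_Ioi).2 (ae_of_all _ fun r hr => (hnorm t ht r hr).le)
  -- The integral over r leaves the power -(1 + Re s)/2 of t, integrable at 0 because Re s < 1.
  · have e : ∀ t ∈ Ioi (0 : ℝ), (t ^ (-((1 + s.re) / 2)) * Real.exp (-c.re * t ^ (1 : ℝ))) *
        (1 / 2 * Real.Gamma (s.re / 2)) = ∫ r in Ioi (0 : ℝ), ‖Function.uncurry (fun r t : ℝ =>
        (r : ℂ) ^ (s - 1) * Complex.exp (-(t * (r : ℂ) ^ 2)) *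
        ((t : ℂ) ^ (1 / 2 - 1 : ℂ) * Complex.exp (-(c * t)))) (r, t)‖ := by
      intro t ht
      simp only [Function.uncurry_def]
      rw [setIntegral_congr_fun measurableSet_Ioi (hnorm t ht), integral_mul_const,
        integral_rpow_mul_exp_neg_mul_rpow (by norm_num) (by linarith) ht, Real.rpow_one,
        show -((1 + s.re) / 2) = -(s.re - 1 + 1) / 2 + -(1 / 2) by ring, Real.rpow_add ht,
        sub_add_cancel]
      ring
    refine IntegrableOn.congr_fun ?_ e measurableSet_Ioi
    exact Integrable.mul_const (integrableOn_rpow_mul_exp_neg_mul_rpow (by linarith) one_pos hc) _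

/-- Schwinger's trick: Γ(1/2) times the inverse square root is a Laplace integral in t. After
exchanging the integrals, the one over r is Gaussian and the one over t is Euler's. -/
theorem integral_cpow_mul_inv_sqrt {s c : ℂ} (hs0 : 0 < s.re) (hs1 : s.re < 1) (hc : 0 < c.re) :
    IntegrableOn (fun r : ℝ => (r : ℂ) ^ (s - 1) * (1 / ((r : ℂ) ^ 2 + c)) ^ (1 / 2 : ℂ)) (Ioi 0) ∧
    (∫ r in Ioi (0 : ℝ), (r : ℂ) ^ (s - 1) * (1 / ((r : ℂ) ^ 2 + c)) ^ (1 / 2 : ℂ)) *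
      Complex.Gamma (1 / 2) =
      1 / 2 * Complex.Gamma (s / 2) * Complex.Gamma ((1 - s) / 2) * (1 / c) ^ ((1 - s) / 2) := by
  have hH := integrable_cpow_mul_exp_prod hs0 hs1 hc
  have hre : ∀ w : ℂ, (w / 2).re = w.re / 2 := fun w => by
    rw [show w / 2 = w * ((1 / 2 : ℝ) : ℂ) by push_cast; ring, Complex.re_mul_ofReal]; ring
  have ht : ∀ r ∈ Ioi (0 : ℝ), ∫ t in Ioi (0 : ℝ), (r : ℂ) ^ (s - 1) *
      Complex.exp (-(t * (r : ℂ) ^ 2)) * ((t : ℂ) ^ (1 / 2 - 1 : ℂ) * Complex.exp (-(c * t))) =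
      (r : ℂ) ^ (s - 1) * (1 / ((r : ℂ) ^ 2 + c)) ^ (1 / 2 : ℂ) * Complex.Gamma (1 / 2) := by
    intro r hr
    have h1 := integral_cpow_mul_exp_neg_mul_of_re_pos (a := 1 / 2) (c := (r : ℂ) ^ 2 + c)
      (by norm_num) (by
        rw [Complex.add_re, ← Complex.ofReal_pow, Complex.ofReal_re]
        positivity)
    rw [mul_assoc, ← h1, ← integral_const_mul]
    refine setIntegral_congr_fun measurableSet_Ioi fun t _ => ?_
    rw [show -(((r : ℂ) ^ 2 + c) * t) = -(t * (r : ℂ) ^ 2) + -(c * t) by ring, Complex.exp_add]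
    ring
  have hr : ∀ t ∈ Ioi (0 : ℝ), ∫ r in Ioi (0 : ℝ), (r : ℂ) ^ (s - 1) *
      Complex.exp (-(t * (r : ℂ) ^ 2)) * ((t : ℂ) ^ (1 / 2 - 1 : ℂ) * Complex.exp (-(c * t))) =
      1 / 2 * Complex.Gamma (s / 2) * ((t : ℂ) ^ ((1 - s) / 2 - 1) * Complex.exp (-(c * t))) := by
    intro t ht
    have ht0 : (t : ℂ) ≠ 0 := by exact_mod_cast (mem_Ioi.1 ht).ne'
    rw [integral_mul_const, integral_cpow_mul_exp_neg_mul_sq hs0 ht,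
      show (1 - s) / 2 - 1 = -(s / 2) + (1 / 2 - 1) by ring, Complex.cpow_add _ _ ht0]
    ring
  have hG : Complex.Gamma (1 / 2) ≠ 0 := Complex.Gamma_ne_zero_of_re_pos (by norm_num)
  constructor
  · have h1 := hH.integral_prod_left
    have h2 : IntegrableOn (fun r : ℝ => (r : ℂ) ^ (s - 1) * (1 / ((r : ℂ) ^ 2 + c)) ^ (1 / 2 : ℂ) *
        Complex.Gamma (1 / 2)) (Ioi 0) :=
      IntegrableOn.congr_fun h1 (fun r hr => ht r hr) measurableSet_Ioi
    have h3 := Integrable.mul_const h2 (Complex.Gamma (1 / 2))⁻¹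
    refine Integrable.congr h3 (ae_of_all _ fun r => ?_)
    exact mul_inv_cancel_right₀ hG _
  · have h1 := integral_integral_swap hH
    rw [setIntegral_congr_fun measurableSet_Ioi ht, setIntegral_congr_fun measurableSet_Ioi hr,
      integral_mul_const, integral_const_mul,
      integral_cpow_mul_exp_neg_mul_of_re_pos (by rw [hre]; simp; linarith) hc] at h1
    rw [h1]
    ring

/-- The complex square `m² ∓ iη` of the mass of a tadpole leg. -/
noncomputable def massSq (m η : ℝ) (marked : Bool) : ℂ :=
  (m : ℂ) ^ 2 - (if marked then -1 else 1) * Complex.I * (η : ℂ)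

theorem massSq_re {m : ℝ} (hm : 0 < m) (η : ℝ) (marked : Bool) : 0 < (massSq m η marked).re := by
  cases marked <;> simp [massSq, ← Complex.ofReal_pow, hm]

theorem tadpoleEnergyValue_eq {m η : ℝ} (hη : 0 < η) (marked : Bool) (r : ℝ) :
    tadpoleEnergyValue m η marked r =
      1 / 2 * (1 / ((r : ℂ) ^ 2 + massSq m η marked)) ^ (1 / 2 : ℂ) := by
  obtain ⟨hre, him⟩ := frequency_re_im (m := m) (r := r) hη
  have hpi : (Real.pi : ℂ) ≠ 0 := by exact_mod_cast Real.pi_ne_zero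
  have e : (if marked then conj (frequency η m r) else frequency η m r) =
      ((r : ℂ) ^ 2 + massSq m η marked) ^ (1 / 2 : ℂ) := by
    cases marked
    · simp only [Bool.false_eq_true, if_false, frequency, massSq]
      ring_nf
    · simp only [if_true]
      rw [FeynmanDiagram.conj_frequency (Or.inl hη)]
      simp only [frequency, massSq, if_true]
      push_cast
      ring_nf
  have harg : ((r : ℂ) ^ 2 + massSq m η marked).arg ≠ Real.pi := by
    refine Complex.slitPlane_arg_ne_pi (Complex.mem_slitPlane_iff.2 (Or.inr ?_))
    cases marked <;> simp [massSq, ← Complex.ofReal_pow, hη.ne']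
  have h0 : ((r : ℂ) ^ 2 + massSq m η marked) ^ (1 / 2 : ℂ) ≠ 0 := by
    rw [← e]
    have : frequency η m r ≠ 0 := by intro h; simp [h] at him
    cases marked <;> simpa using this
  rw [tadpoleEnergyValue, integral_propagator_self hre him, e, one_div ((r : ℂ) ^ 2 + _),
    Complex.inv_cpow _ _ harg]
  field_simp

/-- The tadpole in dimensional regularization, as a function of the dimension. -/
noncomputable def tadpoleDimReg (c D : ℂ) : ℂ :=
  Complex.Gamma (1 - D / 2) / (4 * Real.pi : ℂ) ^ (D / 2) * c ^ ((D - 2) / 2)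

/-- The reciprocal is entire, because 1/Γ is, and inversion preserves normal form. -/
theorem meromorphicNFOn_tadpoleDimReg {c : ℂ} (hc : c ≠ 0) : MeromorphicNFOn (tadpoleDimReg c) univ := by
  have hpi : (4 * Real.pi : ℂ) ≠ 0 := by simp [Real.pi_ne_zero]
  have e : tadpoleDimReg c = (fun D : ℂ => (Complex.Gamma (1 - D / 2))⁻¹ * (4 * Real.pi : ℂ) ^ (D / 2) *
      c ^ (-((D - 2) / 2)))⁻¹ := by
    funext D
    simp only [tadpoleDimReg, Pi.inv_apply, mul_inv, inv_inv, Complex.cpow_neg, div_eq_mul_inv]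
  rw [e, meromorphicNFOn_inv]
  refine AnalyticOnNhd.meromorphicNFOn (Complex.analyticOnNhd_univ_iff_differentiable.2 ?_)
  refine Differentiable.mul (Differentiable.mul ?_ ?_) ?_
  · exact Complex.differentiable_one_div_Gamma.comp (by fun_prop)
  · exact Differentiable.const_cpow (by fun_prop) (Or.inl hpi)
  · exact Differentiable.const_cpow (by fun_prop) (Or.inl hc)

/-- The radial formula with s = D - 1: the Gamma function in the area of the sphere cancels Γ(s/2),
and Γ(1/2) = √π combines with the other powers of 2 and π. -/
theorem tadpoleDimReg_eq_integral {c D : ℂ} (hc : 0 < c.re) (h1 : 1 < D.re) (h2 : D.re < 2) :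
    IntegrableOn (fun r : ℝ => (r : ℂ) ^ (D - 2) * (1 / 2 * (1 / ((r : ℂ) ^ 2 + c)) ^ (1 / 2 : ℂ)))
      (Ioi 0) ∧
    tadpoleDimReg c D = 2 * (Real.pi : ℂ) ^ ((D - 1) / 2) * (Complex.Gamma ((D - 1) / 2))⁻¹
      * ((2 * Real.pi : ℂ) ^ (D - 1))⁻¹ *
        ∫ r : ℝ in Ioi 0, (r : ℂ) ^ (D - 2) * (1 / 2 * (1 / ((r : ℂ) ^ 2 + c)) ^ (1 / 2 : ℂ)) := by
  obtain ⟨hi, he⟩ := integral_cpow_mul_inv_sqrt (s := D - 1) (c := c) (by simp; linarith)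
    (by simp; linarith) hc
  rw [show D - 1 - 1 = D - 2 by ring] at hi he
  have e : ∀ r : ℝ, (r : ℂ) ^ (D - 2) * (1 / 2 * (1 / ((r : ℂ) ^ 2 + c)) ^ (1 / 2 : ℂ)) =
      1 / 2 * ((r : ℂ) ^ (D - 2) * (1 / ((r : ℂ) ^ 2 + c)) ^ (1 / 2 : ℂ)) := fun r => by ring
  simp only [e]
  refine ⟨Integrable.const_mul hi _, ?_⟩
  rw [integral_const_mul]
  have hG : Complex.Gamma ((D - 1) / 2) ≠ 0 := Complex.Gamma_ne_zero_of_re_pos (by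
    rw [show (D - 1) / 2 = (D - 1) * ((1 / 2 : ℝ) : ℂ) by push_cast; ring, Complex.re_mul_ofReal]
    simp; linarith)
  have hc0 : c ≠ 0 := by rintro rfl; simp at hc
  have hcpow : (1 / c) ^ ((1 - (D - 1)) / 2) = c ^ ((D - 2) / 2) := by
    rw [one_div, Complex.inv_cpow _ _ (Complex.slitPlane_arg_ne_pi
      (Complex.mem_slitPlane_iff.2 (Or.inl hc))), ← Complex.cpow_neg]
    congr 1
    ring
  have hpi0 : (Real.pi : ℂ) ≠ 0 := by exact_mod_cast Real.pi_ne_zero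
  have h4 : (4 * Real.pi : ℂ) ^ (D / 2) = 2 ^ D * (Real.pi : ℂ) ^ (D / 2) := by
    rw [show (4 * Real.pi : ℂ) = ((4 : ℝ) : ℂ) * (Real.pi : ℂ) by push_cast; ring,
      Complex.mul_cpow_ofReal_nonneg (by norm_num) Real.pi_pos.le,
      show (4 : ℝ) = (2 : ℝ) ^ (2 : ℝ) by norm_num, ofReal_rpow_two_cpow (by norm_num)]
    norm_num
    congr 1
    ring
  have h5 : (2 * Real.pi : ℂ) ^ (D - 1) = 2 ^ D / 2 * ((Real.pi : ℂ) ^ (D / 2) *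
      (Real.pi : ℂ) ^ ((D - 1) / 2) / (Real.pi : ℂ) ^ (1 / 2 : ℂ)) := by
    rw [show (2 * Real.pi : ℂ) = ((2 : ℝ) : ℂ) * (Real.pi : ℂ) by push_cast; ring,
      Complex.mul_cpow_ofReal_nonneg (by norm_num) Real.pi_pos.le, ← Complex.cpow_add _ _ hpi0,
      ← Complex.cpow_sub _ _ hpi0, Complex.ofReal_ofNat, Complex.cpow_sub _ _ two_ne_zero,
      Complex.cpow_one]
    congr 2
    ring
  have hGh : Complex.Gamma (1 / 2) = (Real.pi : ℂ) ^ (1 / 2 : ℂ) := Complex.Gamma_one_half_eq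
  have hp1 : (Real.pi : ℂ) ^ (1 / 2 : ℂ) ≠ 0 := by simp [Complex.cpow_eq_zero_iff, hpi0]
  have hp2 : (Real.pi : ℂ) ^ ((D - 1) / 2) ≠ 0 := by simp [Complex.cpow_eq_zero_iff, hpi0]
  have hp3 : (Real.pi : ℂ) ^ (D / 2) ≠ 0 := by simp [Complex.cpow_eq_zero_iff, hpi0]
  have hp4 : (2 : ℂ) ^ D ≠ 0 := by simp [Complex.cpow_eq_zero_iff]
  rw [hGh, hcpow, show (1 - (D - 1)) / 2 = 1 - D / 2 by ring] at he
  rw [tadpoleDimReg, h4, h5, eq_div_of_mul_eq hp1 he]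
  field_simp

theorem isDimReg_tadpole {m η : ℝ} (hm : 0 < m) (hη : 0 < η) (marked : Bool) :
    IsDimReg (tadpoleEnergyValue m η marked) (tadpoleDimReg (massSq m η marked)) := by
  have hc := massSq_re hm η marked
  refine ⟨meromorphicNFOn_tadpoleDimReg (by intro h; simp [h] at hc), 1, 2, by norm_num,
    fun D h1 h2 => ?_⟩
  simp only [tadpoleEnergyValue_eq hη]
  exact tadpoleDimReg_eq_integral hc h1 h2

/-- The radial integral of the tadpole converges only between one and two dimensions. -/
theorem one_lt_and_lt_two_of_integrableOn {c : ℂ} {x : ℝ} (hc : 0 < c.re)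
    (h : IntegrableOn (fun r : ℝ => (r : ℂ) ^ ((x : ℂ) - 2) *
      (1 / 2 * (1 / ((r : ℂ) ^ 2 + c)) ^ (1 / 2 : ℂ))) (Ioi 0)) : 1 < x ∧ x < 2 := by
  -- Since |r² + c| is at most 1 + |c| for r < 1 and r²(1 + |c|) for r > 1, the integrand is at
  -- least K r^(x-2) near 0 and K r^(x-3) near infinity.
  set K : ℝ := 1 / 2 * (1 / (1 + ‖c‖)) ^ (1 / 2 : ℝ) with hK
  have hK0 : 0 < K := by positivity
  have hnorm : ∀ r : ℝ, 0 < r → ‖(r : ℂ) ^ ((x : ℂ) - 2) * (1 / 2 * (1 / ((r : ℂ) ^ 2 + c)) ^ (1 / 2 : ℂ))‖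
      = r ^ (x - 2) * (1 / 2 * (1 / ‖(r : ℂ) ^ 2 + c‖) ^ (1 / 2 : ℝ)) := by
    intro r hr
    rw [norm_mul, norm_mul, Complex.norm_cpow_eq_rpow_re_of_pos hr,
      show (1 / 2 : ℂ) = ((1 / 2 : ℝ) : ℂ) by norm_num, Complex.norm_cpow_real]
    simp
  have hpos : ∀ r : ℝ, 0 < ‖(r : ℂ) ^ 2 + c‖ := by
    intro r
    refine norm_pos_iff.2 fun h0 => ?_
    have := congrArg Complex.re h0
    rw [Complex.add_re, ← Complex.ofReal_pow, Complex.ofReal_re, Complex.zero_re] at this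
    nlinarith [sq_nonneg r]
  have hle : ∀ r : ℝ, ‖(r : ℂ) ^ 2 + c‖ ≤ r ^ 2 + ‖c‖ := by
    intro r
    refine (norm_add_le _ _).trans (le_of_eq ?_)
    simp
  have h' : IntegrableOn (fun r : ℝ => ‖(r : ℂ) ^ ((x : ℂ) - 2) *
      (1 / 2 * (1 / ((r : ℂ) ^ 2 + c)) ^ (1 / 2 : ℂ))‖) (Ioi 0) := h.norm
  constructor
  · have h1 : IntegrableOn (fun r : ℝ => r ^ (x - 2)) (Ioo 0 1) := by
      refine Integrable.mono' ((h'.mono_set Ioo_subset_Ioi_self).const_mul K⁻¹)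
        (by fun_prop) ?_
      refine (ae_restrict_iff' measurableSet_Ioo).2 (ae_of_all _ fun r hr => ?_)
      rw [Real.norm_of_nonneg (Real.rpow_nonneg hr.1.le _), hnorm r hr.1, inv_mul_eq_div, le_div_iff₀ hK0]
      refine mul_le_mul_of_nonneg_left ?_ (Real.rpow_nonneg hr.1.le _)
      refine mul_le_mul_of_nonneg_left (Real.rpow_le_rpow (by positivity) ?_ (by norm_num)) (by norm_num)
      refine one_div_le_one_div_of_le (hpos r) ((hle r).trans ?_)
      nlinarith [hr.1, hr.2]
    have := (intervalIntegral.integrableOn_Ioo_rpow_iff one_pos).1 h1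
    linarith
  · have h1 : IntegrableOn (fun r : ℝ => r ^ (x - 3)) (Ioi 1) := by
      refine Integrable.mono' ((h'.mono_set (Ioi_subset_Ioi zero_le_one)).const_mul K⁻¹)
        (by fun_prop) ?_
      refine (ae_restrict_iff' measurableSet_Ioi).2 (ae_of_all _ fun r hr => ?_)
      have hr1 : 1 < r := hr
      have hr0 : 0 < r := by linarith
      rw [Real.norm_of_nonneg (Real.rpow_nonneg hr0.le _), hnorm r hr0, inv_mul_eq_div, le_div_iff₀ hK0,
        show x - 3 = x - 2 + -1 by ring, Real.rpow_add hr0, mul_assoc]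
      refine mul_le_mul_of_nonneg_left ?_ (Real.rpow_nonneg hr0.le _)
      have e : r ^ (-1 : ℝ) * K = 1 / 2 * (1 / (r ^ 2 * (1 + ‖c‖))) ^ (1 / 2 : ℝ) := by
        have e1 : r ^ (-1 : ℝ) = (1 / r ^ 2) ^ (1 / 2 : ℝ) := by
          rw [one_div, ← Real.rpow_natCast, ← Real.rpow_neg hr0.le, ← Real.rpow_mul hr0.le]
          norm_num
        rw [hK, e1, mul_left_comm, ← Real.mul_rpow (by positivity) (by positivity)]
        congr 2
        field_simp
      rw [e]
      refine mul_le_mul_of_nonneg_left (Real.rpow_le_rpow (by positivity) ?_ (by norm_num)) (by norm_num)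
      refine one_div_le_one_div_of_le (hpos r) ((hle r).trans ?_)
      have : ‖c‖ ≤ r ^ 2 * ‖c‖ := le_mul_of_one_le_left (norm_nonneg c) (by nlinarith)
      linarith
    have := (integrableOn_Ioi_rpow_iff one_pos).1 h1
    linarith

/-- Meromorphic functions in normal form that agree near a point agree everywhere. -/
theorem MeromorphicNFOn.eq_of_eventuallyEq {f g : ℂ → ℂ} (hf : MeromorphicNFOn f univ)
    (hg : MeromorphicNFOn g univ) {x : ℂ} (h : f =ᶠ[𝓝 x] g) : f = g := by
  have hs : MeromorphicOn (f - g) univ := hf.meromorphicOn.sub hg.meromorphicOn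
  have hx : meromorphicOrderAt (f - g) x = ⊤ := by
    rw [meromorphicOrderAt_eq_top_iff]
    filter_upwards [h.filter_mono nhdsWithin_le_nhds] with y hy
    simp [hy]
  funext y
  have hy : meromorphicOrderAt (f - g) y = ⊤ := by
    by_contra hy
    exact hs.meromorphicOrderAt_ne_top_of_isPreconnected isPreconnected_univ (mem_univ y)
      (mem_univ x) hy hx
  rw [meromorphicOrderAt_eq_top_iff] at hy
  have h2 : f =ᶠ[𝓝[≠] y] g := by
    filter_upwards [hy] with z hz
    simpa [sub_eq_zero] using hz
  exact (((hf (mem_univ y)).eventuallyEq_nhdsNE_iff_eventuallyEq_nhds (hg (mem_univ y))).1 h2).eq_of_nhds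

/-- `dimReg` picks an unspecified continuation, so uniqueness is needed: its strip must lie in 1 <
Re D < 2, where it equals the explicit function, and normal forms that agree on an open set
coincide. -/
theorem dimReg_tadpole {m η : ℝ} (hm : 0 < m) (hη : 0 < η) (marked : Bool) (D : ℂ) :
    dimReg (tadpoleEnergyValue m η marked) D = tadpoleDimReg (massSq m η marked) D := by
  have hex : ∃ f, IsDimReg (tadpoleEnergyValue m η marked) f := ⟨_, isDimReg_tadpole hm hη marked⟩
  rw [dimReg, dif_pos hex]
  obtain ⟨hNF, a, b, hab, h⟩ := hex.choose_spec
  set f := hex.choose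
  have hc := massSq_re hm η marked
  have hstrip : ∀ x : ℝ, a < x → x < b → 1 < x ∧ x < 2 := by
    intro x h1 h2
    have := (h x (by simpa) (by simpa)).1
    simp only [tadpoleEnergyValue_eq hη] at this
    exact one_lt_and_lt_two_of_integrableOn hc this
  have heq : ∀ D : ℂ, a < D.re → D.re < b → f D = tadpoleDimReg (massSq m η marked) D := by
    intro D h1 h2
    obtain ⟨h3, h4⟩ := hstrip D.re h1 h2
    rw [(h D h1 h2).2, (tadpoleDimReg_eq_integral hc h3 h4).2]
    simp only [tadpoleEnergyValue_eq hη]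
  have hev : f =ᶠ[𝓝 (((a + b) / 2 : ℝ) : ℂ)] tadpoleDimReg (massSq m η marked) := by
    have h1 : {D : ℂ | a < D.re} ∈ 𝓝 (((a + b) / 2 : ℝ) : ℂ) :=
      (isOpen_lt continuous_const Complex.continuous_re).mem_nhds (by
        rw [mem_ofPred_eq, Complex.ofReal_re]; linarith)
    have h2 : {D : ℂ | D.re < b} ∈ 𝓝 (((a + b) / 2 : ℝ) : ℂ) :=
      (isOpen_lt Complex.continuous_re continuous_const).mem_nhds (by
        rw [mem_ofPred_eq, Complex.ofReal_re]; linarith)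
    filter_upwards [h1, h2] with D hD1 hD2 using heq D hD1 hD2
  exact congrFun (hNF.eq_of_eventuallyEq (isDimReg_tadpole hm hη marked).1 hev) D

/-- Both complex squares m² ∓ iη tend to m² > 0, inside the slit plane where the power is
continuous, so the limit does not see the marking. -/
theorem tendsto_dimReg_tadpole {m : ℝ} (hm : 0 < m) (marked : Bool) (D : ℂ) :
    Tendsto (fun η : ℝ => dimReg (tadpoleEnergyValue m η marked) D) (𝓝[>] 0)
      (𝓝 (Complex.Gamma (1 - D / 2) / (4 * Real.pi : ℂ) ^ (D / 2) * (m : ℂ) ^ (D - 2))) := by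
  have hev : ∀ η ∈ Ioi (0 : ℝ), tadpoleDimReg (massSq m η marked) D =
      dimReg (tadpoleEnergyValue m η marked) D := fun η hη => (dimReg_tadpole hm hη marked D).symm
  refine Tendsto.congr' (eventually_nhdsWithin_of_forall hev) (Tendsto.const_mul _ ?_)
  have e : (m : ℂ) ^ (D - 2) = (massSq m 0 marked) ^ ((D - 2) / 2) := by
    have h1 := ofReal_rpow_two_cpow hm ((D - 2) / 2)
    rw [Real.rpow_two, show 2 * ((D - 2) / 2) = D - 2 by ring] at h1
    rw [← h1]
    simp [massSq]
  rw [e]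
  refine Tendsto.cpow ?_ tendsto_const_nhds
    (Complex.mem_slitPlane_iff.2 (Or.inl (massSq_re hm 0 marked)))
  have : Continuous fun η : ℝ => massSq m η marked := by unfold massSq; fun_prop
  exact (this.tendsto 0).mono_left nhdsWithin_le_nhds

/-! ### The main theorem -/

theorem mainTheorem3 {V Leg X E W : Type*} [Fintype V] [DecidableEq V] [Nonempty V]
    [Fintype Leg] [DecidableEq Leg] [Fintype X]
    [NormedAddCommGroup E] [InnerProductSpace ℝ E] [AddCommGroup W] [Module ℂ W]
    (G : FeynmanDiagram V Leg X) (ε : Leg → ℝ) (hε : ∀ i, 0 < ε i) :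
    -- diagrams without tadpoles
    (G.TadpoleFree →
      -- a polarized monomial integrates to zero over the energy of its polarized loop
      (∀ (isTau : Leg → Bool) (s : Leg → ℤˣ) (γ : G.Loop), γ.Polarized s →
        ∀ q : Leg → ℝ × E,
          Integrable (fun e : ℝ => ∏ i, polarNumber (frequency (ε i) (G.mass i) ‖(q i).2‖)
            (isTau i) (s i) ((q i).1 + γ.flow i * e)) ∧
          ∫ e : ℝ, ∏ i, polarNumber (frequency (ε i) (G.mass i) ‖(q i).2‖)
            (isTau i) (s i) ((q i).1 + γ.flow i * e) = 0) ∧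
      -- the loop energies are integrated at fixed space momenta, and then the space momenta are
      -- integrated with an arbitrary linear regularization `R`
      (∀ (L : ℕ) (p : X → ℝ × E) (ρ : G.Routing L p),
        (∀ M k, Integrable (fun e : Fin L → ℝ => G.integrand ε ρ M e k)) ∧
        (∀ k, CuttingEquation (fun M => G.energyValue ε ρ M k)) ∧
        ∀ (dom : Submodule ℂ ((Fin L → E) → ℂ)) (R : dom →ₗ[ℂ] W)
          (hdom : ∀ M, G.energyValue ε ρ M ∈ dom),
          CuttingEquation (fun M => R ⟨G.energyValue ε ρ M, hdom M⟩)) ∧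
      -- integrals over the loop momenta in `d + 1` dimensions, possibly with a cutoff `Λ` on the
      -- space momenta
      (∀ (d L : ℕ) (p : X → ℝ × EuclideanSpace ℝ (Fin d)) (ρ : G.Routing L p)
        (Λ : Set (Fin L → EuclideanSpace ℝ (Fin d))), MeasurableSet Λ →
        (Bornology.IsBounded Λ → ∀ M, IntegrableOn
          (fun x : (Fin L → ℝ) × (Fin L → EuclideanSpace ℝ (Fin d)) =>
            G.integrand ε ρ M x.1 x.2) (univ ×ˢ Λ)) ∧
        ((∀ M, IntegrableOn
          (fun x : (Fin L → ℝ) × (Fin L → EuclideanSpace ℝ (Fin d)) =>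
            G.integrand ε ρ M x.1 x.2) (univ ×ˢ Λ)) →
          CuttingEquation (G.loopValue ε ρ Λ)))) ∧
    -- tadpole assumption: the cutting equation extends to diagrams with tadpoles
    (∀ t : Leg → Bool → ℂ, G.TadpoleAssumption t →
      ∀ (L : ℕ) (p : X → ℝ × E) (ρ : G.dropTadpoles.Routing L p)
        (dom : Submodule ℂ ((Fin L → E) → ℂ)) (R : dom →ₗ[ℂ] W)
        (hdom : ∀ M, G.dropTadpoles.energyValue (fun i => ε i) ρ M ∈ dom),
        CuttingEquation (fun M => G.tadpoleFactor t M •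
          R ⟨G.dropTadpoles.energyValue (fun i => ε i) ρ M, hdom M⟩)) ∧
    -- the loop energies, including those of the tadpoles, are integrated at fixed space momenta, and
    -- the widths of the tadpoles are sent to zero
    ((∀ i, G.IsTadpole i → 0 < G.mass i) →
      ∀ (L : ℕ) (p : X → ℝ × E) (ρ : G.Routing L p),
        (∀ M k, Integrable (fun e : Fin L → ℝ => G.integrand ε ρ M e k)) ∧
        ∃ A : Finset V → (Fin L → E) → ℂ,
          (∀ M k, Tendsto (fun η : Leg → ℝ => G.energyValue (G.withTadpoleWidths ε η) ρ M k)
            (𝓝[{η | ∀ i, 0 < η i}] 0) (𝓝 (A M k))) ∧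
          (∀ k, CuttingEquation (fun M => A M k)) ∧
          ∀ (dom : Submodule ℂ ((Fin L → E) → ℂ)) (R : dom →ₗ[ℂ] W) (hdom : ∀ M, A M ∈ dom),
            CuttingEquation (fun M => R ⟨A M, hdom M⟩)) ∧
    -- the tadpoles in dimensional regularization
    (∀ m η : ℝ, 0 < m → 0 < η → ∀ marked : Bool,
      (∃ f, IsDimReg (tadpoleEnergyValue m η marked) f) ∧
      ∀ D : ℂ, dimReg (tadpoleEnergyValue m η marked) D
        = Complex.Gamma (1 - D / 2) / (4 * Real.pi : ℂ) ^ (D / 2)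
          * ((m : ℂ) ^ 2 - (if marked then -1 else 1) * Complex.I * (η : ℂ)) ^ ((D - 2) / 2)) ∧
    -- in dimensional regularization, with the widths of the tadpoles sent to zero, the tadpole
    -- assumption holds, and so does the cutting equation
    ((∀ i, G.IsTadpole i → 0 < G.mass i) →
      ∀ D : ℂ, (∀ n : ℕ, D ≠ 2 * ((n : ℂ) + 1)) →
      ∃ t : Leg → Bool → ℂ,
        (∀ i, G.IsTadpole i → ∀ marked : Bool,
          t i marked = Complex.Gamma (1 - D / 2) / (4 * Real.pi : ℂ) ^ (D / 2)
            * (G.mass i : ℂ) ^ (D - 2) ∧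
          Tendsto (fun η : ℝ => dimReg (tadpoleEnergyValue (G.mass i) η marked) D)
            (𝓝[>] 0) (𝓝 (t i marked))) ∧
        G.TadpoleAssumption t ∧
        ∀ (L : ℕ) (p : X → ℝ × E) (ρ : G.dropTadpoles.Routing L p)
          (dom : Submodule ℂ ((Fin L → E) → ℂ)) (R : dom →ₗ[ℂ] W)
          (hdom : ∀ M, G.dropTadpoles.energyValue (fun i => ε i) ρ M ∈ dom),
          CuttingEquation (fun M => G.tadpoleFactor t M •
            R ⟨G.dropTadpoles.energyValue (fun i => ε i) ρ M, hdom M⟩)) := by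
  refine ⟨fun hG => ⟨fun isTau s γ hγ q => ?_, fun L p ρ => ⟨?_, ?_, ?_⟩,
    fun d L p ρ Λ hΛ => ⟨?_, ?_⟩⟩, fun t ht L p ρ dom R hdom => ?_, fun hm L p ρ => ⟨?_, ?_⟩,
    fun m η hm hη marked => ⟨⟨_, isDimReg_tadpole hm hη marked⟩, dimReg_tadpole hm hη marked⟩,
    fun hm D _ => ?_⟩
  · exact FeynmanDiagram.integral_polarized_loop hG (fun i => (frequency_re_im (hε i)).2) isTau s γ hγ
      fun i => (q i).1
  · exact FeynmanDiagram.integrable_integrand hε ρ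
  · exact FeynmanDiagram.cuttingEquation_energyValue hG hε ρ
  · exact FeynmanDiagram.cuttingEquation_map (FeynmanDiagram.cuttingEquation_energyValue hG hε ρ)
  · exact FeynmanDiagram.integrableOn_integrand hG hε ρ hΛ
  · exact FeynmanDiagram.cuttingEquation_loopValue hG hε ρ Λ
  · exact FeynmanDiagram.cuttingEquation_tadpoleFactor_smul hε ht L p ρ dom R hdom
  · exact FeynmanDiagram.integrable_integrand hε ρ
  · obtain ⟨A, h1, h2⟩ := FeynmanDiagram.exists_tendsto_energyValue hε hm ρ
    exact ⟨A, h1, h2, FeynmanDiagram.cuttingEquation_map h2⟩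
  -- The values ignore the mark, so the two sides of the tadpole assumption differ only in the place
  -- of the minus sign.
  · have ht : G.TadpoleAssumption fun i _ => Complex.Gamma (1 - D / 2) / (4 * Real.pi : ℂ) ^ (D / 2)
        * (G.mass i : ℂ) ^ (D - 2) := fun v _ => neg_mul _ _
    exact ⟨_, fun i hi marked => ⟨rfl, tendsto_dimReg_tadpole (hm i hi) marked D⟩, ht,
      fun L p ρ dom R hdom => FeynmanDiagram.cuttingEquation_tadpoleFactor_smul hε ht L p ρ dom R hdom⟩
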